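/- For real parameters $c=(\mathrm a,\mathrm b)$ let $F=F_c:\mathbb R^2\to\mathbb R^2$ be the map $F(x,y)=(\mathrm a x-y,\,x)$ if $x>0$ or ($x=0$ and $y\le 0$), and $F(x,y)=(\mathrm b x-y,\,x)$ otherwise. The symbolic word of the $F$-orbit of a point has the letter $a$ or $b$ at time $t$ according to which of the two formulae applies to the $t$-th iterate. The rotation number $\theta(c)$ is the limit, as $N\to\infty$, of $\frac1N$ times the number of occurrences of the factor $ab$ in the prefix of length $N$ of the symbolic word; saying that $\theta(c)=\theta$ means that this limit exists and equals $\theta$ for every nonzero initial point. A word $w=w_0\cdots w_{N-1}$ in $a,b$ of length $N\ge 2$ is positive if it starts with $a$ and negative if it starts with $b$; put $z_0=(0,-1)$ if $w$ is positive, $z_0=(0,1)$ if $w$ is negative, and $z_t=F^t(z_0)$. A parameter pair $c$ is legal for $w$ if $z_N$ lies on the line $x=0$ and $w_t$ equals the $t$-th letter of the symbolic word of $z_0$ for every $0\le t<N$ for which $z_t$ does not lie on the line $x=0$. Let $Q_0=0$, $Q_1=1$, $Q_{t+1}=w_tQ_t-Q_{t-1}$, polynomials in $a,b$, let $k=\lfloor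 N/2\rfloor$, and let $C_w=Q_{k+1}-Q_k$ if $N$ is odd, $C_w=Q_{k+1}-Q_{k-1}$ if $N$ is even. For $w$ of odd rank (that is, with first letter equal to last letter) let $\mathcal C_w$ be the legal branch of the critical curve $\{c\in\mathbb R^2: C_w(c)=0\}$, that is, its branch (connected component) that contains legal points for $w$. Let $\zeta_j=2\cos(\pi/j)$, let $\mathcal D_{\kappa,\ell}=[\zeta_\kappa,\zeta_{\kappa+1}]\times[\zeta_\ell,\zeta_{\ell+1}]$, and let $$\vartheta^{\pm}_{j,m}=\frac{m}{mj\pm1}.$$ **Corollary.** Let $\kappa,\ell\ge 2$ and $n,m\ge 0$ be integers. For each of the following two choices of words $w,w'$ and of the number $\vartheta$, 1. $w=(a^{\kappa+1}b^{\ell})^n a^{\kappa}$, $\ w'=(b^{\ell+1}a^{\kappa})^m b^{\ell}$, $\ \vartheta=\vartheta^-_{\kappa+\ell+1,\,n+m+1}$; 2. $w=a^{\kappa+1}(b^{\ell+1}a^{\kappa})^n$, $\ w'=b^{\ell+1}(a^{\kappa+1}b^{\ell})^m$, $\ \vartheta=\vartheta^+_{\kappa+\ell+1,\,n+m+1}$;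 the curves $\mathcal C_w$ and $\mathcal C_{w'}$ intersect within $\mathcal D_{\kappa,\ell}$, and $\theta(c)=\vartheta$ at every point $c\in\mathcal C_w\cap\mathcal C_{w'}$ that lies in $\mathcal D_{\kappa,\ell}$ or is legal for both $w$ and $w'$. -/

import Mathlib

open Filter Topology

namespace CriticalCurves

noncomputable section

/-- The two letters, naming the two half-planes on which the planar map is linear. -/
inductive Letter
  | a
  | b
  deriving DecidableEq

/-- The real parameter attached to a letter at the parameter pair `c = (a, b)`. -/
def Letter.value (c : ℝ × ℝ) : Letter → ℝ
  | .a => c.1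
  | .b => c.2

open Classical in
/-- The letter of the half-plane containing `z`; the closed negative ordinate semi-axis
belongs to the half-plane of `a`, the open positive one to that of `b`. -/
def symbol (z : ℝ × ℝ) : Letter :=
  if 0 < z.1 ∨ (z.1 = 0 ∧ z.2 ≤ 0) then .a else .b

/-- The piecewise linear map `F (x, y) = (a x - y, x)` or `(b x - y, x)`,
according to the half-plane containing `(x, y)`. -/
def F (c z : ℝ × ℝ) : ℝ × ℝ :=
  ((symbol z).value c * z.1 - z.2, z.1)

/-- The symbolic word of the `F`-orbit of `z`. -/
def code (c z : ℝ × ℝ) (t : ℕ) : Letter :=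
  symbol ((F c)^[t] z)

/-- The number of occurrences of the factor `ab` in the prefix of length `n` of the
symbolic word of the orbit of `z`. -/
def abCount (c z : ℝ × ℝ) (n : ℕ) : ℕ :=
  ((Finset.range n).filter fun t =>
    t + 1 < n ∧ code c z t = .a ∧ code c z (t + 1) = .b).card

/-- The rotation number of `F` at the parameter pair `c` exists and equals `θ`: for every
nonzero initial point the frequency of the factor `ab` in the symbolic word tends to `θ`. -/
def HasRotationNumber (c : ℝ × ℝ) (θ : ℝ) : Prop :=
  ∀ z : ℝ × ℝ, z ≠ 0 → Tendsto (fun n : ℕ => (abCount c z n : ℝ) / n) atTop (𝓝 θ)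

/-- Point on the initial boundary ray of a word: `(0, -1)` for a positive word (first letter
`a`), `(0, 1)` for a negative word (first letter `b`). -/
def startPoint : List Letter → ℝ × ℝ
  | .b :: _ => (0, 1)
  | _ => (0, -1)

/-- `c` is a legal point for the word `w = w₀ ⋯ w_{n-1}`: the `F`-orbit of the initial
boundary ray of `w` is on a boundary ray (the ordinate axis) at time `n`, and `w` agrees with
the symbolic word of this orbit segment at all times at which the orbit is not on a boundary
ray. On boundary rays the letter is immaterial, as the two branches of `F` coincide there. -/
def IsLegal (w : List Letter) (c : ℝ × ℝ) : Prop :=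
  ((F c)^[w.length] (startPoint w)).1 = 0 ∧
    ∀ (t : ℕ) (ht : t < w.length),
      ((F c)^[t] (startPoint w)).1 ≠ 0 → w[t] = code c (startPoint w) t

/-- The value at `c` of the signed continuant `Q_t(w₁, …, w_{t-1})`:
`Q₀ = 0`, `Q₁ = 1`, `Q_{t+1} = w_t Q_t - Q_{t-1}`. It is used for `t ≤ w.length` only. -/
def Q (w : List Letter) (c : ℝ × ℝ) : ℕ → ℝ
  | 0 => 0
  | 1 => 1
  | t + 2 => (w.getD (t + 1) .a).value c * Q w c (t + 1) - Q w c t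

/-- The polynomial `C_w` of a word of odd rank and length `n ≥ 2`, evaluated at `c`. With
`k = ⌊n/2⌋` it is `Q_{k+1} - Q_k` for `n` odd and `Q_{k+1} - Q_{k-1}` for `n` even. -/
def C (w : List Letter) (c : ℝ × ℝ) : ℝ :=
  if Odd w.length then Q w c (w.length / 2 + 1) - Q w c (w.length / 2)
  else Q w c (w.length / 2 + 1) - Q w c (w.length / 2 - 1)

/-- The critical curve of a word of odd rank: the zero set of `C_w` in the parameter plane. -/
def curve (w : List Letter) : Set (ℝ × ℝ) :=
  {c | C w c = 0}

/-- The legal branch of the critical curve of `w`: the branch (connected component) containing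
legal points. -/
def legalBranch (w : List Letter) : Set (ℝ × ℝ) :=
  {c | ∃ c₀, IsLegal w c₀ ∧ c ∈ connectedComponentIn (curve w) c₀}

/-- `ζ_j = 2 cos (π / j)`. -/
def zeta (j : ℕ) : ℝ :=
  2 * Real.cos (Real.pi / j)

/-- The rotational domain `D_{κ,ℓ} = [ζ_κ, ζ_{κ+1}] × [ζ_ℓ, ζ_{ℓ+1}]`. -/
def rotDomain (κ ℓ : ℕ) : Set (ℝ × ℝ) :=
  Set.Icc (zeta κ) (zeta (κ + 1)) ×ˢ Set.Icc (zeta ℓ) (zeta (ℓ + 1))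

/-- `θ⁻_{j,m} = m / (m j - 1)`. -/
def thetaMinus (j m : ℕ) : ℝ :=
  (m : ℝ) / ((m : ℝ) * j - 1)

/-- `θ⁺_{j,m} = m / (m j + 1)`. -/
def thetaPlus (j m : ℕ) : ℝ :=
  (m : ℝ) / ((m : ℝ) * j + 1)

/-- The word `a^k`. -/
def aPow (k : ℕ) : List Letter :=
  List.replicate k .a

/-- The word `b^k`. -/
def bPow (k : ℕ) : List Letter :=
  List.replicate k .b

/-- The word `u^n`, the concatenation of `n` copies of `u`. -/
def wordPow (u : List Letter) (n : ℕ) : List Letter :=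
  (List.replicate n u).flatten

/-- The curves of `w` and `w'` meet with rotation number `θ`: their legal branches intersect
within the domain `D`, and the rotation number is `θ` at every intersection point of the legal
branches within `D`, and moreover at every point of the plane, in `D` or not, at which the two
branches meet and which is legal for both words. -/
def MeetWithRotationNumber (D : Set (ℝ × ℝ)) (w w' : List Letter) (θ : ℝ) : Prop :=
  (legalBranch w ∩ legalBranch w' ∩ D).Nonempty ∧
    ∀ c ∈ legalBranch w ∩ legalBranch w',
      (c ∈ D ∨ (IsLegal w c ∧ IsLegal w' c)) → HasRotationNumber c θ

end

end CriticalCurves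

open CriticalCurves

/-!
Measure the angle of a vector from `(0, -1)` in half-turns, so that the boundary rays are the
integer angles. Both formulae for `F` lift to increasing homeomorphisms of the line of angles that
commute with integer translations and do not increase when the parameters do. A legal word moves
its initial ray by one half-turn more than it has changes of letter. For a palindromic tail,
`C_w` vanishes only where the word carries the initial ray to a boundary ray, so along a connected
component of the critical curve the angle of turning of the word is constant; the legal branch is
thus described by a single equation for this angle.

The number `ζ_j` is the parameter at which `j` steps cross a half-plane exactly. In
`D_{κ,ℓ}` the words of the corollary are iterates of a return map followed by a final
passage, and the orbit of a monotone return map is monotone: if the angle of turning is right at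
the end, the orbit has stayed between its two ends and has followed the word. On opposite sides of
`D_{κ,ℓ}` the angle of turning is too large and too small, and it is strictly decreasing in one
parameter, so the two curves meet. At a common legal point `w` carries the ray `(0, -1)` to
`(0, 1)` and `w'` carries it back; the angle then repeats after `|w| + |w'|` steps and
`n + m + 1` full turns, and the factor `ab` occurs once in each full turn.
-/

namespace CriticalCurves

/-! ### The action on directions -/

/-- The linear map `(x, y) ↦ (s x - y, x)`; the two formulae defining `F` are its instances
at the two parameters. -/
def branch (s : ℝ) : ℝ × ℝ →ₗ[ℝ] ℝ × ℝ :=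
  (s • LinearMap.fst ℝ ℝ ℝ - LinearMap.snd ℝ ℝ ℝ).prod (LinearMap.fst ℝ ℝ ℝ)

@[simp] theorem branch_apply (s : ℝ) (z : ℝ × ℝ) : branch s z = (s * z.1 - z.2, z.1) := rfl

theorem F_eq_branch (c z : ℝ × ℝ) : F c z = branch ((symbol z).value c) z := rfl

theorem branch_injective (s : ℝ) : Function.Injective (branch s) := by
  intro z w h
  simp only [branch_apply, Prod.mk.injEq] at h
  exact Prod.ext h.2 (by linear_combination s * h.2 - h.1)

/-- The unit vector at angle `u` from `(0, -1)`, counterclockwise. The unit of angle is the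
half-turn, so that the boundary rays are at the integer angles. -/
noncomputable def direction (u : ℝ) : ℝ × ℝ :=
  (Real.sin (Real.pi * u), -Real.cos (Real.pi * u))

theorem direction_add_one (u : ℝ) : direction (u + 1) = -direction u := by
  simp [direction, mul_add, Real.sin_add_pi, Real.cos_add_pi]

theorem direction_add_two_mul_int (u : ℝ) (k : ℤ) : direction (u + 2 * k) = direction u := by
  have h : Real.pi * (u + 2 * k) = Real.pi * u + k * (2 * Real.pi) := by ring
  simp only [direction, h, Real.sin_add_int_mul_two_pi, Real.cos_add_int_mul_two_pi]

theorem direction_fst_eq_zero_iff {u : ℝ} :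
    (direction u).1 = 0 ↔ u ∈ Set.range ((↑) : ℤ → ℝ) := by
  simp only [direction, Real.sin_eq_zero_iff, Set.mem_range]
  refine exists_congr fun k => ?_
  rw [mul_comm, mul_right_inj' Real.pi_ne_zero]

theorem exists_eq_smul_direction {z : ℝ × ℝ} (hz : z ≠ 0) :
    ∃ r : ℝ, 0 < r ∧ ∃ u, z = r • direction u := by
  let ξ : ℂ := ⟨-z.2, z.1⟩
  have hξ0 : ξ ≠ 0 := fun h => hz (Prod.ext (congrArg Complex.im h)
    (neg_eq_zero.1 (congrArg Complex.re h)))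
  refine ⟨‖ξ‖, norm_pos_iff.2 hξ0, ξ.arg / Real.pi, ?_⟩
  have hre : ‖ξ‖ * Real.cos ξ.arg = -z.2 := Complex.norm_mul_cos_arg ξ
  have him : ‖ξ‖ * Real.sin ξ.arg = z.1 := Complex.norm_mul_sin_arg ξ
  ext <;> simp [direction, mul_div_cancel₀ _ Real.pi_ne_zero, hre, him]

theorem exists_int_of_smul_direction_eq {u v r : ℝ} (hr : 0 < r)
    (h : direction u = r • direction v) : ∃ k : ℤ, u = v + 2 * k := by
  obtain ⟨hs, hc⟩ := Prod.mk.inj h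
  simp only [direction, smul_eq_mul, mul_neg, neg_inj] at hs hc
  have hu := Real.sin_sq_add_cos_sq (Real.pi * u)
  have hv := Real.sin_sq_add_cos_sq (Real.pi * v)
  have hr1 : r = 1 := by
    have : r ^ 2 = 1 := by rw [hs, hc] at hu; linear_combination hu - r ^ 2 * hv
    exact (pow_eq_one_iff_of_nonneg hr.le two_ne_zero).1 this
  have hcos : Real.cos (Real.pi * u - Real.pi * v) = 1 := by
    rw [Real.cos_sub, hs, hc, hr1]
    linarith
  obtain ⟨k, hk⟩ := (Real.cos_eq_one_iff _).1 hcos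
  exact ⟨k, mul_left_cancel₀ Real.pi_ne_zero (by linear_combination -hk)⟩

/-- The complex number by which the shear `(x, y) ↦ (x, y - s x)` multiplies `direction u`,
when the plane is identified with `ℂ`. -/
noncomputable def shearFactor (s u : ℝ) : ℂ :=
  ⟨1 + s * Real.sin (Real.pi * u) * Real.cos (Real.pi * u),
    -(s * Real.sin (Real.pi * u) ^ 2)⟩

theorem shearFactor_mem_slitPlane (s u : ℝ) : shearFactor s u ∈ Complex.slitPlane := by
  rw [Complex.mem_slitPlane_iff]
  by_cases h : s * Real.sin (Real.pi * u) = 0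
  · left
    simp [shearFactor, h]
  · right
    simpa [shearFactor] using h

theorem continuous_shearFactor : Continuous fun p : ℝ × ℝ => shearFactor p.1 p.2 := by
  simp only [shearFactor, Complex.mk_eq_add_mul_I]
  fun_prop

theorem shearFactor_add_one (s u : ℝ) : shearFactor s (u + 1) = shearFactor s u := by
  simp [shearFactor, mul_add, Real.sin_add_pi, Real.cos_add_pi]

/-- The angle of the image of `direction u` under `branch s`, which is a shear followed by a
quarter-turn. Being in the slit plane, the factor of the shear has a continuous argument. -/
noncomputable def turnAngle (s u : ℝ) : ℝ :=
  u + 1 / 2 + (shearFactor s u).arg / Real.pi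

theorem continuous_turnAngle : Continuous fun p : ℝ × ℝ => turnAngle p.1 p.2 := by
  have : Continuous fun p : ℝ × ℝ => (shearFactor p.1 p.2).arg :=
    continuous_iff_continuousAt.2 fun p =>
      (Complex.continuousAt_arg (shearFactor_mem_slitPlane _ _)).comp
        (f := fun p : ℝ × ℝ => shearFactor p.1 p.2) continuous_shearFactor.continuousAt
  unfold turnAngle
  fun_prop

theorem turnAngle_add_one (s u : ℝ) : turnAngle s (u + 1) = turnAngle s u + 1 := by
  simp only [turnAngle, shearFactor_add_one]
  ring

theorem turnAngle_zero (s : ℝ) : turnAngle s 0 = 1 / 2 := by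
  have : shearFactor s 0 = 1 := by apply Complex.ext <;> simp [shearFactor]
  simp [turnAngle, this]

theorem branch_direction (s u : ℝ) :
    branch s (direction u) = ‖shearFactor s u‖ • direction (turnAngle s u) := by
  have hangle : Real.pi * turnAngle s u
      = Real.pi * u + (shearFactor s u).arg + Real.pi / 2 := by
    unfold turnAngle; field_simp; ring
  have hre : ‖shearFactor s u‖ * Real.cos (shearFactor s u).arg
      = 1 + s * Real.sin (Real.pi * u) * Real.cos (Real.pi * u) :=
    Complex.norm_mul_cos_arg _
  have him : ‖shearFactor s u‖ * Real.sin (shearFactor s u).arg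
      = -(s * Real.sin (Real.pi * u) ^ 2) :=
    Complex.norm_mul_sin_arg _
  have hsq := Real.sin_sq_add_cos_sq (Real.pi * u)
  ext <;> simp only [branch_apply, direction, Prod.smul_mk, smul_eq_mul, hangle, Real.sin_add,
    Real.cos_add, Real.sin_pi_div_two, Real.cos_pi_div_two]
  · linear_combination (-Real.cos (Real.pi * u)) * hre + Real.sin (Real.pi * u) * him
      - s * Real.sin (Real.pi * u) * hsq
  · linear_combination (-Real.sin (Real.pi * u)) * hre - Real.cos (Real.pi * u) * him

theorem norm_shearFactor_pos (s u : ℝ) : 0 < ‖shearFactor s u‖ :=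
  norm_pos_iff.2 (Complex.slitPlane_ne_zero (shearFactor_mem_slitPlane s u))

theorem turnAngle_injective (s : ℝ) : Function.Injective (turnAngle s) := by
  intro u v h
  have hv := norm_shearFactor_pos s v
  have himage : branch s (direction u)
      = branch s ((‖shearFactor s u‖ / ‖shearFactor s v‖) • direction v) := by
    rw [map_smul, branch_direction, branch_direction, h, smul_smul, div_mul_cancel₀ _ hv.ne']
  obtain ⟨k, rfl⟩ := exists_int_of_smul_direction_eq (div_pos (norm_shearFactor_pos s u) hv)
    (branch_injective s himage)
  have hperiodic : turnAngle s (v + 2 * k) = turnAngle s v + 2 * k := by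
    have : shearFactor s (v + 2 * k) = shearFactor s v := by
      have := direction_add_two_mul_int v k
      simp only [direction, Prod.mk.injEq, neg_inj] at this
      simp only [shearFactor, this]
    simp only [turnAngle, this]
    ring
  linarith

theorem turnAngle_strictMono (s : ℝ) : StrictMono (turnAngle s) := by
  have hcont : Continuous (turnAngle s) :=
    continuous_turnAngle.comp (by fun_prop : Continuous fun u => (s, u))
  refine (hcont.strictMono_of_inj (turnAngle_injective s)).resolve_right fun h => ?_
  have := h (show (0 : ℝ) < 0 + 1 by norm_num)
  rw [turnAngle_add_one] at this
  linarith

/-- `turnAngle s` as a lift of a circle map of degree one; a circle of length one stands for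
the projective line. -/
noncomputable def turn (s : ℝ) : CircleDeg1Lift where
  toFun := turnAngle s
  monotone' := (turnAngle_strictMono s).monotone
  map_add_one' := turnAngle_add_one s

theorem turn_apply (s u : ℝ) : turn s u = turnAngle s u := rfl

theorem continuous_turn : Continuous fun p : ℝ × ℝ => turn p.1 p.2 := continuous_turnAngle

theorem turn_strictMono (s : ℝ) : StrictMono (turn s) := turnAngle_strictMono s

theorem turn_int (s : ℝ) (k : ℤ) : turn s k = k + 1 / 2 := by
  rw [← zero_add (k : ℝ), CircleDeg1Lift.map_add_int, turn_apply, turnAngle_zero]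
  ring

theorem turn_zero (s : ℝ) : turn s 0 = 1 / 2 := turnAngle_zero s

theorem turn_one (s : ℝ) : turn s 1 = 3 / 2 := by
  have := turn_int s 1
  rw [Int.cast_one] at this
  linarith

theorem exists_branch_direction (s u : ℝ) :
    ∃ r : ℝ, 0 < r ∧ branch s (direction u) = r • direction (turn s u) :=
  ⟨_, norm_shearFactor_pos s u, branch_direction s u⟩

theorem map_add_two_mul_int (f : CircleDeg1Lift) (u : ℝ) (k : ℤ) :
    f (u + 2 * k) = f u + 2 * k := by
  have := f.map_add_int u (2 * k)
  push_cast at this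
  exact this

theorem turn_strictAnti_left {u : ℝ} (hu : u ∉ Set.range ((↑) : ℤ → ℝ)) :
    StrictAnti fun s => turn s u := by
  have hfst : (direction u).1 ≠ 0 := mt direction_fst_eq_zero_iff.1 hu
  have hcont : Continuous fun s => turn s u :=
    continuous_turn.comp (by fun_prop : Continuous fun s => (s, u))
  have hinj : Function.Injective fun s => turn s u := by
    intro s t (h : turn s u = turn t u)
    obtain ⟨r, -, hs⟩ := exists_branch_direction s u
    obtain ⟨r', -, ht⟩ := exists_branch_direction t u
    rw [h] at hs
    simp only [branch_apply, Prod.ext_iff, Prod.smul_fst, Prod.smul_snd, smul_eq_mul] at hs ht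
    have hsnd : (direction (turn t u)).2 ≠ 0 := fun h0 => hfst (by rw [hs.2, h0, mul_zero])
    have hrr : r = r' := mul_right_cancel₀ hsnd (hs.2.symm.trans ht.2)
    rw [hrr] at hs
    exact mul_right_cancel₀ hfst (by linarith [hs.1, ht.1])
  refine (hcont.strictMono_of_inj hinj).resolve_left fun h => ?_
  have h01 : turn 0 u < turn 1 u := h one_pos
  have hzero : shearFactor 0 u = 1 := by apply Complex.ext <;> simp [shearFactor]
  have hone : (shearFactor 1 u).arg < 0 := by
    rw [Complex.arg_neg_iff]
    have : 0 < (direction u).1 ^ 2 := by positivity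
    simpa [shearFactor, direction] using this
  simp only [turn_apply, turnAngle, hzero, Complex.arg_one, zero_div] at h01
  have := div_neg_of_neg_of_pos hone Real.pi_pos
  linarith

theorem turn_antitone : Antitone turn := by
  intro s t hst u
  by_cases hu : u ∈ Set.range ((↑) : ℤ → ℝ)
  · obtain ⟨k, rfl⟩ := hu
    rw [turn_int, turn_int]
  · exact (turn_strictAnti_left hu).antitone hst

/-- The composition of the lifts `turn` of the linear maps prescribed by the letters of a
word, the first letter acting first. -/
noncomputable def wordTurn (c : ℝ × ℝ) : List Letter → CircleDeg1Lift
  | [] => 1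
  | l :: w => wordTurn c w * turn (l.value c)

theorem wordTurn_cons (c : ℝ × ℝ) (l : Letter) (w : List Letter) (u : ℝ) :
    wordTurn c (l :: w) u = wordTurn c w (turn (l.value c) u) := rfl

theorem wordTurn_append (c : ℝ × ℝ) (v w : List Letter) :
    wordTurn c (v ++ w) = wordTurn c w * wordTurn c v := by
  induction v with
  | nil => exact (mul_one _).symm
  | cons l v ih => simp only [List.cons_append, wordTurn, ih, mul_assoc]

theorem wordTurn_replicate (c : ℝ × ℝ) (l : Letter) (p : ℕ) :
    wordTurn c (List.replicate p l) = turn (l.value c) ^ p := by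
  induction p with
  | zero => rfl
  | succ p ih => rw [List.replicate_succ, wordTurn, ih, pow_succ]

theorem wordPow_succ (u : List Letter) (n : ℕ) : wordPow u (n + 1) = u ++ wordPow u n := by
  simp [wordPow, List.replicate_succ]

theorem wordTurn_strictMono (c : ℝ × ℝ) (w : List Letter) : StrictMono (wordTurn c w) := by
  induction w with
  | nil => exact strictMono_id
  | cons l w ih => exact ih.comp (turn_strictMono _)

theorem continuous_value (l : Letter) : Continuous fun c : ℝ × ℝ => l.value c := by
  cases l
  exacts [continuous_fst, continuous_snd]

theorem continuous_wordTurn (w : List Letter) (u : ℝ) :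
    Continuous fun c : ℝ × ℝ => wordTurn c w u := by
  suffices ∀ f : ℝ × ℝ → ℝ, Continuous f → Continuous fun c => wordTurn c w (f c) from
    this _ continuous_const
  induction w with
  | nil => exact fun f hf => hf
  | cons l _ ih =>
    exact fun f hf => ih _ (continuous_turn.comp ((continuous_value l).prodMk hf))

theorem wordTurn_antitone {c d : ℝ × ℝ} (h : ∀ l : Letter, l.value c ≤ l.value d)
    (w : List Letter) : wordTurn d w ≤ wordTurn c w := by
  induction w with
  | nil => exact le_rfl
  | cons l w ih =>
    exact fun u => (ih _).trans ((wordTurn c w).monotone (turn_antitone (h l) u))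

/-- The letter of the half-plane whose angles are between `k` and `k + 1`. -/
def side (k : ℤ) : Letter :=
  if Even k then .a else .b

theorem side_add_two_mul (k j : ℤ) : side (k + 2 * j) = side k := by
  simp [side, Int.even_add]

theorem side_add_one_ne (k : ℤ) : side (k + 1) ≠ side k := by
  by_cases h : Even k <;> simp [side, h]

theorem side_add_one_of_ne {k : ℤ} {l x : Letter} (hk : side k = l) (hx : x ≠ l) :
    side (k + 1) = x := by
  subst hk
  by_cases h : Even k <;> cases x <;> simp_all [side]

/-- The angles of the vectors of the closed half-plane of a letter. -/
def halfPlane (l : Letter) : Set ℝ :=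
  {u | ∃ k : ℤ, side k = l ∧ u ∈ Set.Icc (k : ℝ) (k + 1)}

theorem mem_halfPlane_add {l : Letter} {i : ℤ} (hi : side i = l) {u : ℝ}
    (hu : u ∈ Set.Icc (0 : ℝ) 1) : u + i ∈ halfPlane l :=
  ⟨i, hi, by linarith [hu.1], by linarith [hu.2]⟩

theorem mem_halfPlane_iff {l : Letter} {u : ℝ} :
    u ∈ halfPlane l ↔ side ⌊u⌋ = l ∨ u ∈ Set.range ((↑) : ℤ → ℝ) := by
  constructor
  · rintro ⟨k, hk, hu⟩
    rcases hu.2.lt_or_eq with h | h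
    · exact Or.inl (by rwa [Int.floor_eq_iff.2 ⟨hu.1, h⟩])
    · exact Or.inr ⟨k + 1, by rw [h]; push_cast; rfl⟩
  · rintro (h | ⟨k, rfl⟩)
    · exact ⟨⌊u⌋, h, Int.floor_le u, (Int.lt_floor_add_one u).le⟩
    · by_cases h : side k = l
      · exact ⟨k, h, le_rfl, by linarith⟩
      · refine ⟨k - 1, ?_, by push_cast; linarith, by push_cast; linarith⟩
        rw [← side_add_one_of_ne rfl (Ne.symm h), ← side_add_two_mul (k - 1) 1]
        congr 1
        ring

theorem symbol_smul {r : ℝ} (hr : 0 < r) (z : ℝ × ℝ) : symbol (r • z) = symbol z := by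
  simp [symbol, hr, hr.ne', hr.le, hr.not_ge, mul_nonpos_iff]

theorem symbol_direction (u : ℝ) : symbol (direction u) = side ⌊u⌋ := by
  have hpos {f : ℝ} (h₀ : 0 ≤ f) (h₁ : f < 1) :
      0 < (direction f).1 ∨ (direction f).1 = 0 ∧ (direction f).2 < 0 := by
    rcases h₀.eq_or_lt with rfl | h₀
    · simp [direction]
    · have := Real.pi_pos
      exact Or.inl (Real.sin_pos_of_pos_of_lt_pi (by positivity) (by nlinarith))
  have hfract := hpos (Int.fract_nonneg u) (Int.fract_lt_one u)
  have hu := Int.fract_add_floor u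
  rcases Int.even_or_odd' ⌊u⌋ with ⟨k, hk | hk⟩ <;> rw [hk] at hu <;> push_cast at hu
  · have hdir : direction u = direction (Int.fract u) :=
      (congrArg direction hu.symm).trans (direction_add_two_mul_int _ k)
    rw [hdir, hk, symbol, if_pos (hfract.imp_right (And.imp_right le_of_lt))]
    simp [side]
  · have hdir : direction u = -direction (Int.fract u) := by
      rw [← direction_add_one, ← direction_add_two_mul_int (Int.fract u + 1) k]
      congr 1
      linarith
    rw [hdir, hk, symbol, if_neg]
    · simp [side]
    · simp only [Prod.fst_neg, Prod.snd_neg]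
      rintro (h | h) <;> rcases hfract with h' | h' <;> linarith

/-- The lift of the action of `F` on directions to the line of angles. -/
noncomputable def angleMap (c : ℝ × ℝ) (u : ℝ) : ℝ :=
  turn ((side ⌊u⌋).value c) u

theorem turn_eq_angleMap {c : ℝ × ℝ} {l : Letter} {u : ℝ} (hu : u ∈ halfPlane l) :
    turn (l.value c) u = angleMap c u := by
  rcases mem_halfPlane_iff.1 hu with rfl | ⟨k, rfl⟩
  · rfl
  · rw [angleMap, turn_int, turn_int]

theorem F_smul {r : ℝ} (hr : 0 < r) (c z : ℝ × ℝ) : F c (r • z) = r • F c z := by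
  rw [F_eq_branch, symbol_smul hr, map_smul, F_eq_branch]

theorem iterate_F_smul {r : ℝ} (hr : 0 < r) (c z : ℝ × ℝ) (t : ℕ) :
    (F c)^[t] (r • z) = r • (F c)^[t] z :=
  (show Function.Commute (F c) (r • ·) from F_smul hr c).iterate_left t z

theorem exists_iterate_F_direction (c : ℝ × ℝ) (u : ℝ) (t : ℕ) :
    ∃ r : ℝ, 0 < r ∧ (F c)^[t] (direction u) = r • direction ((angleMap c)^[t] u) := by
  induction t with
  | zero => exact ⟨1, one_pos, (one_smul _ _).symm⟩
  | succ t ih =>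
    obtain ⟨r, hr, h⟩ := ih
    obtain ⟨r', hr', h'⟩ := exists_branch_direction
      ((side ⌊(angleMap c)^[t] u⌋).value c) ((angleMap c)^[t] u)
    refine ⟨r * r', mul_pos hr hr', ?_⟩
    rw [Function.iterate_succ_apply', h, F_smul hr, F_eq_branch, symbol_direction, h', smul_smul,
      Function.iterate_succ_apply', angleMap]

theorem code_smul_direction {r : ℝ} (hr : 0 < r) (c : ℝ × ℝ) (u : ℝ) (t : ℕ) :
    code c (r • direction u) t = side ⌊(angleMap c)^[t] u⌋ := by
  obtain ⟨r', hr', h⟩ := exists_iterate_F_direction c u t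
  rw [code, iterate_F_smul hr, symbol_smul hr, h, symbol_smul hr', symbol_direction]

/-- The orbit of the angle `u` under the linear maps prescribed by a word visits the half-planes
prescribed by that word. -/
def Follows (c : ℝ × ℝ) : List Letter → ℝ → Prop
  | [], _ => True
  | l :: w, u => u ∈ halfPlane l ∧ Follows c w (turn (l.value c) u)

theorem follows_append {c : ℝ × ℝ} {v w : List Letter} {u : ℝ} :
    Follows c (v ++ w) u ↔ Follows c v u ∧ Follows c w (wordTurn c v u) := by
  induction v generalizing u with
  | nil => exact (iff_of_eq (true_and _)).symm
  | cons l v ih => simp only [List.cons_append, Follows, ih, and_assoc, wordTurn_cons]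

theorem follows_iff {c : ℝ × ℝ} {w : List Letter} {u : ℝ} :
    Follows c w u ↔ ∀ (t : ℕ) (ht : t < w.length), (angleMap c)^[t] u ∈ halfPlane w[t] := by
  induction w generalizing u with
  | nil => simp [Follows]
  | cons l w ih =>
    constructor
    · rintro ⟨h₀, h⟩ t ht
      cases t with
      | zero => exact h₀
      | succ t => exact ih.1 (turn_eq_angleMap h₀ ▸ h) t (by simpa using ht)
    · intro h
      have h₀ : u ∈ halfPlane l := h 0 (by simp)
      refine ⟨h₀, ?_⟩
      rw [turn_eq_angleMap h₀, ih]
      exact fun t ht => h (t + 1) (by simpa using ht)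

theorem Follows.wordTurn_eq {c : ℝ × ℝ} {w : List Letter} {u : ℝ} (h : Follows c w u) :
    wordTurn c w u = (angleMap c)^[w.length] u := by
  induction w generalizing u with
  | nil => rfl
  | cons l w ih =>
    rw [wordTurn_cons, ih h.2, List.length_cons, Function.iterate_succ_apply,
      turn_eq_angleMap h.1]

theorem startPoint_cons {l : Letter} {i : ℤ} (hi : side i = l) (w : List Letter) :
    startPoint (l :: w) = direction i := by
  subst hi
  rcases Int.even_or_odd' i with ⟨k, rfl | rfl⟩
  · have h : direction (2 * k : ℤ) = direction 0 := by
      rw [← direction_add_two_mul_int 0 k, zero_add]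
      push_cast
      rfl
    rw [h]
    simp [side, startPoint, direction]
  · have h : direction (2 * k + 1 : ℤ) = direction 1 := by
      rw [← direction_add_two_mul_int 1 k, add_comm]
      push_cast
      rfl
    have hb : side (2 * k + 1) = .b := if_neg (Int.not_even_two_mul_add_one k)
    rw [h]
    simp [hb, startPoint, direction]

theorem isLegal_cons_iff {l : Letter} {i : ℤ} (hi : side i = l) (w : List Letter)
    (c : ℝ × ℝ) : IsLegal (l :: w) c ↔
      Follows c (l :: w) i ∧ wordTurn c (l :: w) i ∈ Set.range ((↑) : ℤ → ℝ) := by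
  have hfst (t : ℕ) : ((F c)^[t] (direction i)).1 = 0 ↔
      (angleMap c)^[t] i ∈ Set.range ((↑) : ℤ → ℝ) := by
    obtain ⟨r, hr, h⟩ := exists_iterate_F_direction c i t
    rw [h, Prod.smul_fst, smul_eq_zero_iff_right hr.ne', direction_fst_eq_zero_iff]
  have hcode (t : ℕ) : code c (direction i) t = side ⌊(angleMap c)^[t] (i : ℝ)⌋ := by
    rw [← code_smul_direction one_pos, one_smul]
  have hfollows : Follows c (l :: w) i ↔ ∀ (t : ℕ) (ht : t < (l :: w).length),
      (angleMap c)^[t] (i : ℝ) ∉ Set.range ((↑) : ℤ → ℝ) →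
        (l :: w)[t] = side ⌊(angleMap c)^[t] (i : ℝ)⌋ := by
    simp only [follows_iff, mem_halfPlane_iff, ← or_iff_not_imp_right, eq_comm]
  rw [IsLegal, startPoint_cons hi]
  simp only [hfst, ne_eq, hcode, ← hfollows]
  rw [and_comm]
  exact and_congr_right fun h => by rw [h.wordTurn_eq]

/-- The number of pairs of distinct adjacent letters of the word `l :: w`. -/
def letterChanges (l : Letter) : List Letter → ℕ
  | [] => 0
  | x :: w => (if x = l then 0 else 1) + letterChanges x w

-- Near the boundary ray `k + 1` only the half-planes at `k` and `k + 1` are visible, so the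
-- letter tells which of them the angle belongs to.
theorem mem_Icc_of_mem_halfPlane {k : ℤ} {l x : Letter} {v : ℝ} (hk : side k = l)
    (hv : v ∈ Set.Icc (k + 1 / 2 : ℝ) (k + 3 / 2)) (hx : v ∈ halfPlane x) :
    ∃ j : ℤ, side j = x ∧ v ∈ Set.Icc (j : ℝ) (j + 1) ∧ j = k + if x = l then 0 else 1 := by
  obtain ⟨j, hj, hvj⟩ := hx
  refine ⟨j, hj, hvj, ?_⟩
  have hlower : k ≤ j := by
    have : (k : ℝ) < j + 1 := by linarith [hv.1, hvj.2]
    exact Int.lt_add_one_iff.1 (by exact_mod_cast this)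
  have hupper : j ≤ k + 1 := by
    have : (j : ℝ) < k + 1 + 1 := by linarith [hv.2, hvj.1]
    exact Int.lt_add_one_iff.1 (by exact_mod_cast this)
  rcases hlower.eq_or_lt with rfl | h
  · rw [if_pos (hj.symm.trans hk), add_zero]
  · obtain rfl : j = k + 1 := le_antisymm hupper h
    rw [if_neg]
    rintro rfl
    exact side_add_one_ne k (hj.trans hk.symm)

theorem turn_mem_Icc {s u : ℝ} {k : ℤ} (hu : u ∈ Set.Icc (k : ℝ) (k + 1)) :
    turn s u ∈ Set.Icc (k + 1 / 2 : ℝ) (k + 3 / 2) := by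
  have h₀ := (turn s).monotone hu.1
  have h₁ := (turn s).monotone hu.2
  rw [CircleDeg1Lift.map_add_one, turn_int] at h₁
  rw [turn_int] at h₀
  exact ⟨h₀, by linarith⟩

theorem wordTurn_cons_mem_Icc {c : ℝ × ℝ} {l : Letter} {w : List Letter} {k : ℤ} {u : ℝ}
    (hk : side k = l) (hu : u ∈ Set.Icc (k : ℝ) (k + 1))
    (hw : Follows c w (turn (l.value c) u)) :
    wordTurn c (l :: w) u
      ∈ Set.Icc (k + letterChanges l w + 1 / 2 : ℝ) (k + letterChanges l w + 3 / 2) := by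
  have hturn := turn_mem_Icc (s := l.value c) hu
  induction w generalizing l k u with
  | nil => simpa [letterChanges, wordTurn] using hturn
  | cons x w ih =>
    obtain ⟨j, hj, hvj, hjk⟩ := mem_Icc_of_mem_halfPlane hk hturn hw.1
    have hcount : (k + letterChanges l (x :: w) : ℝ) = j + letterChanges x w := by
      rw [hjk, letterChanges]; push_cast; ring
    rw [hcount]
    exact ih hj hvj hw.2 (turn_mem_Icc hvj)

theorem wordTurn_cons_eq_of_mem_range {c : ℝ × ℝ} {l : Letter} {w : List Letter} {i : ℤ}
    (hi : side i = l) (hw : Follows c (l :: w) i)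
    (hrange : wordTurn c (l :: w) i ∈ Set.range ((↑) : ℤ → ℝ)) :
    wordTurn c (l :: w) i = i + letterChanges l w + 1 := by
  obtain ⟨h₀, h₁⟩ := wordTurn_cons_mem_Icc hi (by simp) hw.2
  obtain ⟨j, hj⟩ := hrange
  rw [← hj] at h₀ h₁ ⊢
  have hlower : i + letterChanges l w < j := by
    exact_mod_cast (by linarith : (i + letterChanges l w : ℝ) < j)
  have hupper : j < i + letterChanges l w + 2 := by
    exact_mod_cast (by linarith : (j : ℝ) < i + letterChanges l w + 2)
  exact_mod_cast (by omega : j = i + letterChanges l w + 1)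

theorem IsLegal.iterate_angleMap {c : ℝ × ℝ} {l : Letter} {w : List Letter}
    (h : IsLegal (l :: w) c) {i : ℤ} (hi : side i = l) :
    (angleMap c)^[(l :: w).length] i = i + letterChanges l w + 1 := by
  obtain ⟨hfollows, hrange⟩ := (isLegal_cons_iff hi w c).1 h
  rw [← hfollows.wordTurn_eq, wordTurn_cons_eq_of_mem_range hi hfollows hrange]

theorem exists_side_eq (l : Letter) : ∃ i : ℤ, side i = l := by
  cases l
  exacts [⟨0, rfl⟩, ⟨1, rfl⟩]

theorem IsLegal.wordTurn_zero {c : ℝ × ℝ} {l : Letter} {w : List Letter}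
    (h : IsLegal (l :: w) c) : wordTurn c (l :: w) 0 = letterChanges l w + 1 := by
  obtain ⟨i, hi⟩ := exists_side_eq l
  obtain ⟨hfollows, hrange⟩ := (isLegal_cons_iff hi w c).1 h
  have := wordTurn_cons_eq_of_mem_range hi hfollows hrange
  rw [← zero_add (i : ℝ), CircleDeg1Lift.map_add_int] at this
  linarith

/-! ### Continuants and critical curves -/

theorem exists_Q_eq (w : List Letter) (c : ℝ × ℝ) (t : ℕ) (ht : t < w.length) :
    ∃ r : ℝ, 0 < r ∧
      (Q w c (t + 1), Q w c t) = r • direction (wordTurn c (w.take (t + 1)) 0) := by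
  induction t with
  | zero =>
    refine ⟨1, one_pos, ?_⟩
    rw [← List.take_append_getElem ht]
    simp [wordTurn, turn_zero, Q, direction, ← div_eq_mul_inv]
  | succ t ih =>
    obtain ⟨r, hr, h⟩ := ih (by omega)
    obtain ⟨r', hr', h'⟩ :=
      exists_branch_direction (w[t + 1].value c) (wordTurn c (w.take (t + 1)) 0)
    refine ⟨r * r', mul_pos hr hr', ?_⟩
    have hQ : (Q w c (t + 1 + 1), Q w c (t + 1)) =
        branch (w[t + 1].value c) (Q w c (t + 1), Q w c t) := by
      rw [Q, List.getD_eq_getElem _ _ ht, branch_apply]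
    rw [hQ, h, map_smul, h', smul_smul, ← List.take_append_getElem ht, wordTurn_append]
    rfl

theorem recurrence_eq_zero_iff {R : Type*} [Ring R] {d v : ℕ → R} {N t : ℕ}
    (h : ∀ t, t + 2 ≤ N → d (t + 2) = v (t + 1) * d (t + 1) - d t) (ht : t + 1 ≤ N) :
    (d t = 0 ∧ d (t + 1) = 0) ↔ (d 0 = 0 ∧ d 1 = 0) := by
  induction t with
  | zero => exact Iff.rfl
  | succ t ih =>
    rw [← ih (by omega), h t ht]
    constructor
    · rintro ⟨h₁, h₂⟩
      exact ⟨by simpa [h₁] using h₂, h₁⟩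
    · rintro ⟨h₀, h₁⟩
      exact ⟨h₁, by simp [h₀, h₁]⟩

theorem getD_cons_eq_of_palindrome {l : Letter} {v : List Letter} (hv : v.Palindrome)
    {s t : ℕ} (hst : s + t + 1 = v.length) :
    (l :: v).getD (s + 1) .a = (l :: v).getD (t + 1) .a := by
  have h : v[s]? = v[t]? := by
    conv_lhs => rw [← hv.reverse_eq, List.getElem?_reverse (by omega)]
    congr 1
    omega
  simp only [List.getD_eq_getElem?_getD, List.getElem?_cons_succ, h]

theorem Q_reflected_recurrence {l : Letter} {v : List Letter} (hv : v.Palindrome)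
    (c : ℝ × ℝ) (μ : ℝ) (t : ℕ) (ht : t + 2 ≤ v.length + 1) :
    Q (l :: v) c (v.length + 1 - (t + 2)) - μ * Q (l :: v) c (t + 2) =
      ((l :: v).getD (t + 1) .a).value c *
          (Q (l :: v) c (v.length + 1 - (t + 1)) - μ * Q (l :: v) c (t + 1))
        - (Q (l :: v) c (v.length + 1 - t) - μ * Q (l :: v) c t) := by
  obtain ⟨s, hs⟩ : ∃ s, v.length = s + t + 1 := ⟨v.length - (t + 1), by omega⟩
  rw [show v.length + 1 - (t + 2) = s by omega, show v.length + 1 - (t + 1) = s + 1 by omega,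
    show v.length + 1 - t = s + 2 by omega, Q, Q, getD_cons_eq_of_palindrome hv hs.symm]
  ring

-- The equation `C = 0` gives the solution `Q_{N-t} - Q_t` of the recurrence two zeros in the
-- middle of the word, next to each other or symmetric, so that this solution vanishes.
theorem C_eq_zero_iff {l : Letter} {v : List Letter} (hv : v.Palindrome) (c : ℝ × ℝ) :
    C (l :: v) c = 0 ↔ Q (l :: v) c (v.length + 1) = 0 ∧ Q (l :: v) c v.length = 1 := by
  have hends {k : ℕ} (hk : k + 1 ≤ v.length + 1) :=
    recurrence_eq_zero_iff (d := fun t => Q (l :: v) c (v.length + 1 - t) - 1 * Q (l :: v) c t)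
      (v := fun t => ((l :: v).getD t .a).value c) (Q_reflected_recurrence hv c 1) hk
  simp only [one_mul, Nat.sub_zero, Nat.add_sub_cancel, Q, sub_zero] at hends
  rw [← sub_eq_zero (b := (1 : ℝ)), C, List.length_cons]
  split_ifs with hodd
  · obtain ⟨k, hk⟩ := hodd
    rw [← hends (k := k) (by omega), show v.length + 1 - k = k + 1 by omega,
      show v.length + 1 - (k + 1) = k by omega, show (v.length + 1) / 2 = k by omega]
    exact ⟨fun h => ⟨h, by linarith⟩, And.left⟩
  · obtain ⟨k, hk⟩ := (Nat.not_odd_iff_even.1 hodd).two_dvd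
    obtain ⟨k, rfl⟩ : ∃ i, k = i + 1 := ⟨k - 1, by omega⟩
    rw [← hends (k := k) (by omega), show v.length + 1 - k = k + 1 + 1 by omega,
      show v.length + 1 - (k + 1) = k + 1 by omega, show (v.length + 1) / 2 = k + 1 by omega]
    exact ⟨fun h => ⟨h, sub_self _⟩, And.left⟩

theorem Q_length_sq_eq_one {l : Letter} {v : List Letter} (hv : v.Palindrome) {c : ℝ × ℝ}
    (h : Q (l :: v) c (v.length + 1) = 0) : Q (l :: v) c v.length ^ 2 = 1 := by
  have := (recurrence_eq_zero_iff
    (d := fun t => Q (l :: v) c (v.length + 1 - t) - Q (l :: v) c v.length * Q (l :: v) c t)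
    (v := fun t => ((l :: v).getD t .a).value c)
    (Q_reflected_recurrence hv c _) le_rfl).2 (by simp [h, Q])
  simp only [Nat.add_sub_cancel_left, Q] at this
  linarith [this.1]

theorem wordTurn_mem_range_of_mem_curve {l : Letter} {v : List Letter} (hv : v.Palindrome)
    {c : ℝ × ℝ} (hc : c ∈ curve (l :: v)) :
    wordTurn c (l :: v) 0 ∈ Set.range ((↑) : ℤ → ℝ) := by
  obtain ⟨r, hr, h⟩ := exists_Q_eq (l :: v) c v.length (by simp)
  rw [List.take_of_length_le (by simp), ((C_eq_zero_iff hv c).1 hc).1] at h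
  have hfst := (congrArg Prod.fst h).symm
  rw [Prod.smul_fst, smul_eq_zero_iff_right hr.ne'] at hfst
  exact direction_fst_eq_zero_iff.1 hfst

theorem mem_curve_of_wordTurn_eq {l : Letter} {v : List Letter} (hv : v.Palindrome)
    {c : ℝ × ℝ} {n : ℕ} (hc : wordTurn c (l :: v) 0 = 2 * n + 1) : c ∈ curve (l :: v) := by
  obtain ⟨r, hr, h⟩ := exists_Q_eq (l :: v) c v.length (by simp)
  have hdir : direction (2 * n + 1) = (0, 1) := by
    have := direction_add_two_mul_int 1 n
    rw [Int.cast_natCast] at this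
    rw [add_comm, this]
    simp [direction]
  rw [List.take_of_length_le (by simp), hc, hdir] at h
  obtain ⟨hlast, hprev⟩ := Prod.mk.inj h
  simp only [smul_eq_mul, mul_zero, mul_one] at hlast hprev
  refine (C_eq_zero_iff hv c).2 ⟨hlast, ?_⟩
  exact (pow_eq_one_iff_of_nonneg (hprev ▸ hr.le) two_ne_zero).1 (Q_length_sq_eq_one hv hlast)

theorem isDiscrete_range_intCast : IsDiscrete (Set.range ((↑) : ℤ → ℝ)) :=
  Int.isClosedEmbedding_coe_real.isEmbedding.isInducing.isDiscrete_range

theorem wordTurn_eq_of_mem_legalBranch {l : Letter} {v : List Letter} (hv : v.Palindrome)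
    {c : ℝ × ℝ} (hc : c ∈ legalBranch (l :: v)) :
    wordTurn c (l :: v) 0 = letterChanges l v + 1 := by
  obtain ⟨c₀, hlegal, hc⟩ := hc
  have hc₀ : c₀ ∈ curve (l :: v) := connectedComponentIn_nonempty_iff.1 ⟨c, hc⟩
  rw [← hlegal.wordTurn_zero]
  exact isPreconnected_connectedComponentIn.constant_of_mapsTo isDiscrete_range_intCast
    (continuous_wordTurn _ _).continuousOn
    (fun d hd => wordTurn_mem_range_of_mem_curve hv (connectedComponentIn_subset _ _ hd))
    hc (mem_connectedComponentIn hc₀)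

theorem IsLegal.mem_legalBranch {l : Letter} {v : List Letter} (hv : v.Palindrome)
    {n : ℕ} (hn : letterChanges l v = 2 * n) {c : ℝ × ℝ} (hc : IsLegal (l :: v) c) :
    c ∈ legalBranch (l :: v) :=
  ⟨c, hc, mem_connectedComponentIn
    (mem_curve_of_wordTurn_eq hv (n := n) (by rw [hc.wordTurn_zero, hn]; push_cast; rfl))⟩

/-! ### The words of the two choices -/

theorem wordPow_append_self (u v : List Letter) (n : ℕ) :
    wordPow (u ++ v) n ++ u = u ++ wordPow (v ++ u) n := by
  induction n with
  | zero => simp [wordPow]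
  | succ n ih => simp [wordPow_succ, ih]

theorem length_wordPow (u : List Letter) (n : ℕ) : (wordPow u n).length = n * u.length := by
  simp [wordPow]

theorem palindrome_append_wordPow {u v : List Letter} (hu : u.Palindrome) (hv : v.Palindrome)
    (n : ℕ) : (u ++ wordPow (v ++ u) n).Palindrome := by
  refine .of_reverse_eq ?_
  have hreverse : (wordPow (v ++ u) n).reverse = wordPow (u ++ v) n := by
    simp [wordPow, List.reverse_flatten, hu.reverse_eq, hv.reverse_eq]
  rw [List.reverse_append, hreverse, hu.reverse_eq, wordPow_append_self]

theorem palindrome_replicate (p : ℕ) (l : Letter) : (List.replicate p l).Palindrome :=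
  .of_reverse_eq (List.reverse_replicate ..)

/-- The word `(l^{p+1} l'^q)^n l^p`. The words of the first choice, to which `thetaMinus`
belongs, have this form for `l = a` and, with the letters and their exponents exchanged, for
`l = b`. -/
def minusWord (l l' : Letter) (p q n : ℕ) : List Letter :=
  wordPow (List.replicate (p + 1) l ++ List.replicate q l') n ++ List.replicate p l

/-- The word `l^{p+1} (l'^{q+1} l^p)^n`. The words of the second choice, to which `thetaPlus`
belongs, have this form, in the same way as `minusWord`. -/
def plusWord (l l' : Letter) (p q n : ℕ) : List Letter :=
  List.replicate (p + 1) l ++ wordPow (List.replicate (q + 1) l' ++ List.replicate p l) n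

theorem exists_minusWord_eq_cons (l l' : Letter) (p q n : ℕ) :
    ∃ v, minusWord l l' (p + 2) q n = l :: l :: v ∧ (l :: v).Palindrome := by
  let u := List.replicate (p + 1) l
  let block := l :: (List.replicate q l' ++ [l])
  have hblock : block.Palindrome := (palindrome_replicate q l').cons_concat l
  refine ⟨List.replicate p l ++ wordPow (block ++ u) n, ?_,
    palindrome_append_wordPow (palindrome_replicate (p + 1) l) hblock n⟩
  have hpower : List.replicate (p + 2 + 1) l ++ List.replicate q l'
      = [l] ++ (u ++ l :: List.replicate q l') := by
    simp only [u, List.replicate_succ' (n := p + 1 + 1)]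
    simp [List.replicate_succ]
  calc minusWord l l' (p + 2) q n
      = (wordPow ([l] ++ (u ++ l :: List.replicate q l')) n ++ [l]) ++ u := by
        rw [minusWord, hpower]; simp [u, List.replicate_succ]
    _ = [l] ++ (wordPow (u ++ block) n ++ u) := by
        rw [wordPow_append_self]; simp [block]
    _ = l :: l :: (List.replicate p l ++ wordPow (block ++ u) n) := by
        rw [wordPow_append_self]; simp [u, List.replicate_succ]

theorem exists_plusWord_eq_cons (l l' : Letter) (p q n : ℕ) :
    ∃ v, plusWord l l' (p + 1) q n = l :: l :: v ∧ (l :: v).Palindrome :=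
  ⟨List.replicate p l ++ wordPow (List.replicate (q + 1) l' ++ List.replicate (p + 1) l) n,
    rfl, palindrome_append_wordPow (palindrome_replicate (p + 1) l)
      (palindrome_replicate (q + 1) l') n⟩

theorem letterChanges_replicate_append_self (l : Letter) (p : ℕ) (w : List Letter) :
    letterChanges l (List.replicate p l ++ w) = letterChanges l w := by
  induction p with
  | zero => rfl
  | succ p ih => simpa [List.replicate_succ, letterChanges] using ih

theorem letterChanges_cons_of_ne {l l' : Letter} (h : l ≠ l') (w : List Letter) :
    letterChanges l' (l :: w) = letterChanges l w + 1 := by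
  rw [letterChanges, if_neg h, add_comm]

theorem letterChanges_replicate_append_of_ne {l l' : Letter} (h : l ≠ l') (p : ℕ)
    (w : List Letter) :
    letterChanges l' (List.replicate (p + 1) l ++ w) = letterChanges l w + 1 := by
  rw [List.replicate_succ, List.cons_append, letterChanges_cons_of_ne h,
    letterChanges_replicate_append_self]

theorem letterChanges_wordPow_append {l l' : Letter} (h : l ≠ l') (p q n : ℕ) (w : List Letter) :
    letterChanges l (wordPow (List.replicate (q + 1) l' ++ List.replicate (p + 1) l) n ++ w)
      = letterChanges l w + 2 * n := by
  induction n with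
  | zero => rfl
  | succ n ih =>
    rw [wordPow_succ, List.append_assoc, List.append_assoc,
      letterChanges_replicate_append_of_ne h.symm, letterChanges_replicate_append_of_ne h, ih]
    ring

theorem letterChanges_plusWord {l l' : Letter} (h : l ≠ l') (p q n : ℕ) :
    letterChanges l (plusWord l l' (p + 1) q n) = 2 * n := by
  rw [plusWord, letterChanges_replicate_append_self, ← List.append_nil (wordPow _ n),
    letterChanges_wordPow_append h, letterChanges, zero_add]

theorem letterChanges_minusWord {l l' : Letter} (h : l ≠ l') (p q n : ℕ) :
    letterChanges l (minusWord l l' (p + 2) (q + 1) n) = 2 * n := by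
  induction n with
  | zero =>
    have := letterChanges_replicate_append_self l (p + 2) []
    rwa [List.append_nil] at this
  | succ n ih =>
    have hword : minusWord l l' (p + 2) (q + 1) (n + 1) = List.replicate (p + 2 + 1) l ++
        (List.replicate (q + 1) l' ++ minusWord l l' (p + 2) (q + 1) n) := by
      simp [minusWord, wordPow_succ]
    obtain ⟨v, hv, -⟩ := exists_minusWord_eq_cons l l' p (q + 1) n
    rw [hword, letterChanges_replicate_append_self, letterChanges_replicate_append_of_ne h.symm,
      hv, letterChanges_cons_of_ne h]
    rw [hv, letterChanges, if_pos rfl] at ih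
    omega

theorem length_minusWord (l l' : Letter) (p q n : ℕ) :
    (minusWord l l' p q n).length = n * (p + 1 + q) + p := by
  simp [minusWord, length_wordPow]

theorem length_plusWord (l l' : Letter) (p q n : ℕ) :
    (plusWord l l' p q n).length = p + 1 + n * (q + 1 + p) := by
  simp [plusWord, length_wordPow]

theorem wordTurn_cons_cons_lt {c d : ℝ × ℝ} (h : ∀ l : Letter, l.value c ≤ l.value d)
    {l : Letter} (hl : l.value c < l.value d) (w : List Letter) :
    wordTurn d (l :: l :: w) 0 < wordTurn c (l :: l :: w) 0 := by
  have hhalf : (1 / 2 : ℝ) ∉ Set.range ((↑) : ℤ → ℝ) := by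
    rintro ⟨k, hk⟩
    have : 2 * k = 1 := by exact_mod_cast (by linarith : (2 * k : ℝ) = 1)
    omega
  simp only [wordTurn_cons, turn_zero]
  exact (wordTurn_antitone h w _).trans_lt
    (wordTurn_strictMono c w (turn_strictAnti_left hhalf hl))

/-! ### Passages through a half-plane -/

theorem turn_pow_succ_apply (s u : ℝ) (p : ℕ) :
    (turn s ^ (p + 1)) u = turn s ((turn s ^ p) u) := by
  rw [pow_succ', CircleDeg1Lift.mul_apply]

theorem turn_pow_half (s : ℝ) (p : ℕ) : (turn s ^ p) (1 / 2) = (turn s ^ (p + 1)) 0 := by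
  rw [pow_succ, CircleDeg1Lift.mul_apply, turn_zero]

theorem turn_pow_strictMono (s : ℝ) (p : ℕ) : StrictMono (turn s ^ p) := by
  rw [CircleDeg1Lift.coe_pow]
  exact (turn_strictMono s).iterate p

theorem turn_pow_antitone (p : ℕ) : Antitone fun s => turn s ^ p := by
  intro s t hst u
  simp only [CircleDeg1Lift.coe_pow]
  exact (turn t).monotone.iterate_le_of_le (turn_antitone hst) p u

theorem exists_sin_eq_smul_direction {α : ℝ} (hα : 0 < Real.sin α) (t : ℕ) :
    ∃ r : ℝ, 0 < r ∧ ((Real.sin (t * α), Real.sin ((t - 1) * α)) : ℝ × ℝ)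
      = r • direction ((turn (2 * Real.cos α) ^ t) 0) := by
  induction t with
  | zero => exact ⟨Real.sin α, hα, by simp [direction]⟩
  | succ t ih =>
    obtain ⟨r, hr, h⟩ := ih
    obtain ⟨r', hr', h'⟩ :=
      exists_branch_direction (2 * Real.cos α) ((turn (2 * Real.cos α) ^ t) 0)
    refine ⟨r * r', mul_pos hr hr', ?_⟩
    rw [turn_pow_succ_apply, mul_smul, ← h', ← map_smul, ← h, branch_apply]
    push_cast
    simp only [add_mul, sub_mul, one_mul, add_sub_cancel_right, Real.sin_add, Real.sin_sub]
    congr 1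
    ring

theorem turn_pow_zero_mem_Icc {α : ℝ} (h₀ : 0 < α) {t : ℕ} (ht : t * α ≤ Real.pi)
    (hα : 0 < Real.sin α) : (turn (2 * Real.cos α) ^ t) 0 ∈ Set.Icc (0 : ℝ) 1 := by
  induction t with
  | zero => simp
  | succ t ih =>
    have hprev : t * α ≤ Real.pi := by push_cast at ht; linarith
    obtain ⟨hlower, hupper⟩ :=
      turn_mem_Icc (s := 2 * Real.cos α) (k := 0) (by simpa using ih hprev)
    rw [← turn_pow_succ_apply, Int.cast_zero, zero_add] at hlower hupper
    refine ⟨by linarith, ?_⟩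
    obtain ⟨r, hr, hdir⟩ := exists_sin_eq_smul_direction hα (t + 1)
    have hsin : Real.sin ((t + 1 : ℕ) * α) = r * Real.sin (Real.pi * _) := congrArg Prod.fst hdir
    have hnonneg := nonneg_of_mul_nonneg_right
      (hsin ▸ Real.sin_nonneg_of_nonneg_of_le_pi (by positivity) ht) hr
    by_contra! hlt
    have hneg := Real.sin_neg_of_neg_of_neg_pi_lt
      (x := Real.pi * ((turn (2 * Real.cos α) ^ (t + 1)) 0 - 2)) (by nlinarith [Real.pi_pos])
      (by nlinarith [Real.pi_pos])
    rw [mul_sub, mul_comm Real.pi 2, Real.sin_sub_two_pi] at hneg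
    linarith

theorem turn_zeta_pow_zero {j : ℕ} (hj : 2 ≤ j) : (turn (zeta j) ^ j) 0 = 1 := by
  have hj' : (2 : ℝ) ≤ j := by exact_mod_cast hj
  have hjα : j * (Real.pi / j) = Real.pi := by field_simp
  have hα : 0 < Real.pi / j := by positivity
  have hsin : 0 < Real.sin (Real.pi / j) :=
    Real.sin_pos_of_pos_of_lt_pi hα (by nlinarith)
  have hmem {t : ℕ} (ht : t ≤ j) : (turn (zeta j) ^ t) 0 ∈ Set.Icc (0 : ℝ) 1 := by
    have htα : t * (Real.pi / j) ≤ j * (Real.pi / j) := by gcongr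
    exact turn_pow_zero_mem_Icc hα (htα.trans_eq hjα) hsin
  obtain ⟨r, hr, hdir⟩ := exists_sin_eq_smul_direction hsin j
  rw [hjα, Real.sin_pi] at hdir
  obtain ⟨k, hk⟩ := direction_fst_eq_zero_iff.1
    ((mul_eq_zero.1 (congrArg Prod.fst hdir).symm).resolve_left hr.ne')
  change k = (turn (zeta j) ^ j) 0 at hk
  have hhalf : 1 / 2 ≤ (turn (zeta j) ^ j) 0 := by
    obtain ⟨i, rfl⟩ : ∃ i, j = i + 1 := ⟨j - 1, by omega⟩
    rw [turn_pow_succ_apply, ← turn_zero (zeta (i + 1))]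
    exact (turn _).monotone (hmem (Nat.le_succ i)).1
  have hle := (hmem le_rfl).2
  rw [← hk] at hhalf hle ⊢
  have hpos : 0 < k := by exact_mod_cast (by linarith : (0 : ℝ) < k)
  have hle_one : k ≤ 1 := by exact_mod_cast hle
  exact_mod_cast (by omega : k = 1)

theorem turn_pow_zero_le_one {j : ℕ} (hj : 2 ≤ j) {s : ℝ} (h : zeta j ≤ s) :
    (turn s ^ j) 0 ≤ 1 :=
  (turn_pow_antitone j h 0).trans_eq (turn_zeta_pow_zero hj)

theorem one_le_turn_pow_zero {j : ℕ} (hj : 2 ≤ j) {s : ℝ} (h : s ≤ zeta j) :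
    1 ≤ (turn s ^ j) 0 :=
  (turn_zeta_pow_zero hj).symm.trans_le (turn_pow_antitone j h 0)

theorem zeta_le_zeta_succ {j : ℕ} (hj : 1 ≤ j) : zeta j ≤ zeta (j + 1) := by
  have hj' : (1 : ℝ) ≤ j := by exact_mod_cast hj
  refine mul_le_mul_of_nonneg_left (Real.cos_le_cos_of_nonneg_of_le_pi (by positivity) ?_ ?_)
    zero_le_two
  · exact div_le_self Real.pi_pos.le hj'
  · gcongr
    simp

theorem pow_mem_uIcc (f : CircleDeg1Lift) (u : ℝ) {j n : ℕ} (hj : j ≤ n) :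
    (f ^ j) u ∈ Set.uIcc u ((f ^ n) u) := by
  simp only [CircleDeg1Lift.coe_pow]
  rcases le_total u (f u) with h | h
  · have := f.monotone.monotone_iterate_of_le_map h
    exact Set.mem_uIcc_of_le (this (Nat.zero_le j)) (this hj)
  · have := f.monotone.antitone_iterate_of_map_le h
    exact Set.mem_uIcc_of_ge (this hj) (this (Nat.zero_le j))

theorem le_pow_of_le_map {f : CircleDeg1Lift} {u : ℝ} (h : u ≤ f u) (n : ℕ) :
    u ≤ (f ^ n) u := by
  rw [CircleDeg1Lift.coe_pow]
  exact f.monotone.monotone_iterate_of_le_map h (Nat.zero_le n)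

theorem pow_le_of_map_le {f : CircleDeg1Lift} {u : ℝ} (h : f u ≤ u) (n : ℕ) :
    (f ^ n) u ≤ u := by
  rw [CircleDeg1Lift.coe_pow]
  exact f.monotone.antitone_iterate_of_map_le h (Nat.zero_le n)

/-- The passage through the word `w`, followed by a full turn of the plane backwards. It returns
the initial sector of a word to itself when `w` winds once around the origin. -/
noncomputable def returnMap (c : ℝ × ℝ) (w : List Letter) : CircleDeg1Lift :=
  CircleDeg1Lift.translate (Multiplicative.ofAdd (-2)) * wordTurn c w

theorem returnMap_apply (c : ℝ × ℝ) (w : List Letter) (u : ℝ) :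
    returnMap c w u = wordTurn c w u - 2 := by
  rw [returnMap, CircleDeg1Lift.mul_apply, CircleDeg1Lift.translate_apply]
  ring

theorem wordTurn_eq_returnMap_add (c : ℝ × ℝ) (w : List Letter) (u : ℝ) :
    wordTurn c w u = returnMap c w u + (2 : ℤ) := by
  rw [returnMap_apply]
  push_cast
  ring

theorem wordTurn_wordPow_append (c : ℝ × ℝ) (v w : List Letter) (n : ℕ) (u : ℝ) :
    wordTurn c (wordPow v n ++ w) u = wordTurn c w ((returnMap c v ^ n) u) + 2 * n := by
  induction n generalizing u with
  | zero => simp [wordPow]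
  | succ n ih =>
    rw [wordPow_succ, List.append_assoc, wordTurn_append, CircleDeg1Lift.mul_apply,
      wordTurn_eq_returnMap_add c v, CircleDeg1Lift.map_add_int, ih, pow_succ,
      CircleDeg1Lift.mul_apply]
    push_cast
    ring

theorem follows_wordPow_append {c : ℝ × ℝ} {l : Letter} {i : ℤ} (hi : side i = l)
    {v w : List Letter} {n : ℕ} {u : ℝ}
    (hv : ∀ j < n, ∀ k, side k = l → Follows c v ((returnMap c v ^ j) u + k))
    (hw : ∀ k, side k = l → Follows c w ((returnMap c v ^ n) u + k)) :
    Follows c (wordPow v n ++ w) (u + i) := by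
  induction n generalizing i u with
  | zero => exact hw i hi
  | succ n ih =>
    have hpow (j : ℕ) : (returnMap c v ^ (j + 1)) u = (returnMap c v ^ j) (returnMap c v u) := by
      rw [pow_succ, CircleDeg1Lift.mul_apply]
    rw [wordPow_succ, List.append_assoc, follows_append, CircleDeg1Lift.map_add_int,
      wordTurn_eq_returnMap_add, add_assoc, ← Int.cast_add]
    refine ⟨hv 0 n.succ_pos i hi, ih ?_ (fun j hj k hk => ?_) fun k hk => ?_⟩
    · simpa [add_comm, hi] using side_add_two_mul i 1
    · exact hpow j ▸ hv (j + 1) (by omega) k hk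
    · exact hpow n ▸ hw k hk

theorem follows_replicate {c : ℝ × ℝ} {l : Letter} {i : ℤ} (hi : side i = l) {p m : ℕ}
    (hm : m ≤ p + 1) {u : ℝ} (h₀ : 0 ≤ u) (h₁ : (turn (l.value c) ^ p) u ≤ 1) :
    Follows c (List.replicate m l) (u + i) := by
  induction m generalizing p u with
  | zero => trivial
  | succ m ih =>
    have hu : u ≤ 1 := by
      refine (turn_pow_strictMono (l.value c) p).le_iff_le.1 (h₁.trans (le_pow_of_le_map ?_ p))
      rw [turn_one]
      norm_num
    refine ⟨mem_halfPlane_add hi ⟨h₀, hu⟩, ?_⟩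
    rw [CircleDeg1Lift.map_add_int]
    cases p with
    | zero =>
      obtain rfl : m = 0 := by omega
      trivial
    | succ p =>
      have hturn : 0 ≤ turn (l.value c) u := by
        have := (turn (l.value c)).monotone h₀
        rw [turn_zero] at this
        linarith
      exact ih (Nat.le_of_succ_le_succ hm) hturn (by rwa [pow_succ] at h₁)

section Blocks

variable {c : ℝ × ℝ} {l l' : Letter} {p q : ℕ}

theorem returnMap_block_apply (i j : ℕ) (u : ℝ) :
    returnMap c (List.replicate i l ++ List.replicate j l') u =
      (turn (l'.value c) ^ j) ((turn (l.value c) ^ i) u) - 2 := by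
  rw [returnMap_apply, wordTurn_append, wordTurn_replicate, wordTurn_replicate,
    CircleDeg1Lift.mul_apply]

theorem wordTurn_minusWord (n : ℕ) : wordTurn c (minusWord l l' p q n) 0 =
    (turn (l.value c) ^ p)
      ((returnMap c (List.replicate (p + 1) l ++ List.replicate q l') ^ n) 0) + 2 * n := by
  rw [minusWord, wordTurn_wordPow_append, wordTurn_replicate]

theorem plusWord_eq_cons (l l' : Letter) (p q n : ℕ) : plusWord l l' p q n =
    l :: (wordPow (List.replicate p l ++ List.replicate (q + 1) l') n ++ List.replicate p l) := by
  rw [wordPow_append_self]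
  rfl

theorem wordTurn_plusWord (n : ℕ) : wordTurn c (plusWord l l' p q n) 0 =
    (turn (l.value c) ^ p)
      ((returnMap c (List.replicate p l ++ List.replicate (q + 1) l') ^ n) (1 / 2)) + 2 * n := by
  rw [plusWord_eq_cons, wordTurn_cons, turn_zero, wordTurn_wordPow_append, wordTurn_replicate]

theorem follows_minusBlock {i : ℤ} (hi : side i = l) (hl : l' ≠ l)
    (hA : 1 ≤ (turn (l.value c) ^ (p + 1)) 0) (hB : (turn (l'.value c) ^ (q + 1)) 0 ≤ 1)
    {v : ℝ} (h₀ : 0 ≤ v) (h₁ : (turn (l.value c) ^ p) v ≤ 1) :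
    Follows c (List.replicate (p + 1) l ++ List.replicate (q + 1) l') (v + i) := by
  obtain ⟨y, hy⟩ : ∃ y, (turn (l.value c) ^ (p + 1)) v = y + 1 := ⟨_, (sub_add_cancel _ 1).symm⟩
  have hy₀ : 0 ≤ y := by linarith [(turn (l.value c) ^ (p + 1)).monotone h₀]
  have hy₁ : y ≤ 1 / 2 := by
    have := (turn (l.value c)).monotone h₁
    rw [← turn_pow_succ_apply, hy, turn_one] at this
    linarith
  have hsplit : y + 1 + i = y + (i + 1 : ℤ) := by push_cast; ring
  rw [follows_append, wordTurn_replicate, CircleDeg1Lift.map_add_int, hy, hsplit]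
  refine ⟨follows_replicate hi le_rfl h₀ h₁,
    follows_replicate (side_add_one_of_ne hi hl) le_rfl hy₀ ?_⟩
  exact ((turn (l'.value c) ^ q).monotone hy₁).trans (turn_pow_half _ q ▸ hB)

theorem follows_replicate_of_le_half {i : ℤ} (hi : side i = l)
    (hA : (turn (l.value c) ^ (p + 1)) 0 ≤ 1) {v : ℝ} (h₀ : 0 ≤ v) (h₁ : v ≤ 1 / 2) :
    Follows c (List.replicate (p + 1) l) (v + i) :=
  follows_replicate hi le_rfl h₀
    (((turn (l.value c) ^ p).monotone h₁).trans (turn_pow_half _ p ▸ hA))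

theorem follows_plusBlock {i : ℤ} (hi : side i = l) (hl : l' ≠ l)
    (hA : (turn (l.value c) ^ (p + 1)) 0 ≤ 1) {v : ℝ} (h₀ : 0 ≤ v) (h₁ : v ≤ 1 / 2)
    (hv : 1 ≤ (turn (l.value c) ^ (p + 1)) v)
    (hreturn : returnMap c (List.replicate (p + 1) l ++ List.replicate (q + 1) l') v ≤ 1 / 2) :
    Follows c (List.replicate (p + 1) l ++ List.replicate (q + 1) l') (v + i) := by
  obtain ⟨y, hy⟩ : ∃ y, (turn (l.value c) ^ (p + 1)) v = y + 1 := ⟨_, (sub_add_cancel _ 1).symm⟩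
  have hB : (turn (l'.value c) ^ q) y ≤ 1 := by
    rw [returnMap_block_apply, hy, CircleDeg1Lift.map_add_one, turn_pow_succ_apply] at hreturn
    rw [← (turn_strictMono (l'.value c)).le_iff_le, turn_one]
    linarith
  have hsplit : y + 1 + i = y + (i + 1 : ℤ) := by push_cast; ring
  rw [follows_append, wordTurn_replicate, CircleDeg1Lift.map_add_int, hy, hsplit]
  exact ⟨follows_replicate_of_le_half hi hA h₀ h₁,
    follows_replicate (side_add_one_of_ne hi hl) le_rfl (by linarith) hB⟩

theorem follows_minusWord {i : ℤ} (hi : side i = l) (hl : l' ≠ l)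
    (hA : (turn (l.value c) ^ p) 0 ≤ 1) (hA' : 1 ≤ (turn (l.value c) ^ (p + 1)) 0)
    (hB : (turn (l'.value c) ^ (q + 1)) 0 ≤ 1) {n : ℕ}
    (h : wordTurn c (minusWord l l' p (q + 1) n) 0 = 2 * n + 1) :
    Follows c (minusWord l l' p (q + 1) n) i := by
  rw [wordTurn_minusWord] at h
  set M := returnMap c (List.replicate (p + 1) l ++ List.replicate (q + 1) l')
  have hend : (turn (l.value c) ^ p) ((M ^ n) 0) = 1 := by linarith
  have hend_nonneg : 0 ≤ (M ^ n) 0 :=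
    (turn_pow_strictMono _ p).le_iff_le.1 (hA.trans_eq hend.symm)
  have horbit {j : ℕ} (hj : j ≤ n) : (M ^ j) 0 ∈ Set.Icc 0 ((M ^ n) 0) :=
    Set.uIcc_of_le hend_nonneg ▸ pow_mem_uIcc M 0 hj
  have hle_one {j : ℕ} (hj : j ≤ n) : (turn (l.value c) ^ p) ((M ^ j) 0) ≤ 1 :=
    ((turn (l.value c) ^ p).monotone (horbit hj).2).trans_eq hend
  rw [minusWord, ← zero_add (i : ℝ)]
  exact follows_wordPow_append hi
    (fun j hj k hk => follows_minusBlock hk hl hA' hB (horbit hj.le).1 (hle_one hj.le))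
    fun k hk => follows_replicate hk p.le_succ (horbit le_rfl).1 (hle_one le_rfl)

theorem follows_plusWord {i : ℤ} (hi : side i = l) (hl : l' ≠ l)
    (hA : (turn (l.value c) ^ (p + 1)) 0 ≤ 1) (hA' : 1 ≤ (turn (l.value c) ^ (p + 2)) 0) {n : ℕ}
    (h : wordTurn c (plusWord l l' (p + 1) q n) 0 = 2 * n + 1) :
    Follows c (plusWord l l' (p + 1) q n) i := by
  rw [wordTurn_plusWord] at h
  set M := returnMap c (List.replicate (p + 1) l ++ List.replicate (q + 1) l')
  have hmono := turn_pow_strictMono (l.value c) (p + 1)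
  have hend : (turn (l.value c) ^ (p + 1)) ((M ^ n) (1 / 2)) = 1 := by linarith
  have hend_le : (M ^ n) (1 / 2) ≤ 1 / 2 := by
    rw [← hmono.le_iff_le, hend, turn_pow_half]
    exact hA'
  have horbit {j : ℕ} (hj : j ≤ n) : (M ^ j) (1 / 2) ∈ Set.Icc ((M ^ n) (1 / 2)) (1 / 2) :=
    Set.uIcc_of_ge hend_le ▸ pow_mem_uIcc M (1 / 2) hj
  have hone_le {j : ℕ} (hj : j ≤ n) : 1 ≤ (turn (l.value c) ^ (p + 1)) ((M ^ j) (1 / 2)) :=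
    hend.symm.trans_le (hmono.monotone (horbit hj).1)
  have hnonneg {j : ℕ} (hj : j ≤ n) : 0 ≤ (M ^ j) (1 / 2) :=
    hmono.le_iff_le.1 (hA.trans (hone_le hj))
  have hnext {j : ℕ} (hj : j < n) : M ((M ^ j) (1 / 2)) ≤ 1 / 2 := by
    rw [← CircleDeg1Lift.mul_apply, ← pow_succ']
    exact (horbit hj).2
  have hstart : (i : ℝ) ∈ halfPlane l := by
    simpa using mem_halfPlane_add hi (u := 0) (by simp)
  rw [plusWord_eq_cons]
  refine ⟨hstart, ?_⟩
  rw [turn_int, add_comm (i : ℝ)]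
  exact follows_wordPow_append hi
    (fun j hj k hk => follows_plusBlock hk hl hA (hnonneg hj.le) (horbit hj.le).2 (hone_le hj.le)
      (hnext hj))
    fun k hk => follows_replicate_of_le_half hk hA (hnonneg le_rfl) (horbit le_rfl).2

theorem le_wordTurn_minusWord (hA : (turn (l.value c) ^ p) 0 = 1)
    (hB : 1 ≤ (turn (l'.value c) ^ (q + 1)) 0) (n : ℕ) :
    2 * n + 1 ≤ wordTurn c (minusWord l l' p q n) 0 := by
  have hreturn : 0 ≤ returnMap c (List.replicate (p + 1) l ++ List.replicate q l') 0 := by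
    rw [returnMap_block_apply, turn_pow_succ_apply, hA, turn_one,
      show (3 / 2 : ℝ) = 1 / 2 + 1 by norm_num, CircleDeg1Lift.map_add_one, turn_pow_half]
    linarith
  rw [wordTurn_minusWord]
  linarith [(turn (l.value c) ^ p).monotone (le_pow_of_le_map hreturn n)]

theorem wordTurn_minusWord_le (hA : (turn (l.value c) ^ p) 0 ≤ 1)
    (hA' : (turn (l.value c) ^ (p + 1)) 0 = 1) (hB : (turn (l'.value c) ^ q) 0 ≤ 1) (n : ℕ) :
    wordTurn c (minusWord l l' p q n) 0 ≤ 2 * n + 1 := by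
  have hreturn : returnMap c (List.replicate (p + 1) l ++ List.replicate q l') 0 ≤ 0 := by
    rw [returnMap_block_apply, hA', ← zero_add 1, CircleDeg1Lift.map_add_one]
    linarith
  rw [wordTurn_minusWord]
  linarith [(turn (l.value c) ^ p).monotone (pow_le_of_map_le hreturn n)]

theorem le_wordTurn_plusWord (hA : (turn (l.value c) ^ p) 0 = 1)
    (hB : 1 ≤ (turn (l'.value c) ^ (q + 1)) 0) (n : ℕ) :
    2 * n + 1 ≤ wordTurn c (plusWord l l' p q n) 0 := by
  have hhalf : (turn (l.value c) ^ p) (1 / 2) = 1 / 2 + 1 := by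
    rw [turn_pow_half, turn_pow_succ_apply, hA, turn_one]
    norm_num
  have hreturn :
      1 / 2 ≤ returnMap c (List.replicate p l ++ List.replicate (q + 1) l') (1 / 2) := by
    rw [returnMap_block_apply, hhalf, CircleDeg1Lift.map_add_one, turn_pow_half,
      turn_pow_succ_apply]
    have := (turn (l'.value c)).monotone hB
    rw [turn_one] at this
    linarith
  rw [wordTurn_plusWord]
  linarith [(turn (l.value c) ^ p).monotone (le_pow_of_le_map hreturn n)]

theorem wordTurn_plusWord_le (hA : (turn (l.value c) ^ (p + 1)) 0 = 1)
    (hB : (turn (l'.value c) ^ q) 0 ≤ 1) (n : ℕ) :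
    wordTurn c (plusWord l l' p q n) 0 ≤ 2 * n + 1 := by
  have hreturn :
      returnMap c (List.replicate p l ++ List.replicate (q + 1) l') (1 / 2) ≤ 1 / 2 := by
    rw [returnMap_block_apply, turn_pow_half, hA, turn_pow_succ_apply]
    have hone : (turn (l'.value c) ^ q) 1 ≤ 1 + 1 := by
      rw [← zero_add 1, CircleDeg1Lift.map_add_one]
      linarith
    have := (turn (l'.value c)).monotone hone
    rw [CircleDeg1Lift.map_add_one, turn_one] at this
    linarith
  rw [wordTurn_plusWord]
  have := (turn (l.value c) ^ p).monotone (pow_le_of_map_le hreturn n)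
  rw [turn_pow_half, hA] at this
  linarith

end Blocks

/-! ### Zeros in a rectangle -/

theorem isPreconnected_fiber_of_injOn {X Y Z : Type*} [TopologicalSpace X] [T2Space X]
    [TopologicalSpace Y] [T2Space Y] [TopologicalSpace Z] [T1Space Z] {s : Set X} {t : Set Y}
    (hs : IsCompact s) (ht : IsCompact t) (ht' : IsPreconnected t) {f : X × Y → Z}
    (hf : ContinuousOn f (s ×ˢ t)) (hinj : ∀ y ∈ t, Set.InjOn (fun x => f (x, y)) s) {z : Z}
    (hz : ∀ y ∈ t, ∃ x ∈ s, f (x, y) = z) : IsPreconnected (s ×ˢ t ∩ f ⁻¹' {z}) := by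
  have hcompact : IsCompact (s ×ˢ t ∩ f ⁻¹' {z}) :=
    (hs.prod ht).of_isClosed_subset
      (hf.preimage_isClosed_of_isClosed (hs.prod ht).isClosed isClosed_singleton)
      Set.inter_subset_left
  have := isCompact_iff_compactSpace.1 hcompact
  let proj : ↥(s ×ˢ t ∩ f ⁻¹' {z}) → Y := fun p => p.1.2
  have hproj : IsClosedMap proj := Continuous.isClosedMap (by fun_prop)
  have hproj_inj : Function.Injective proj := by
    rintro ⟨⟨x, y⟩, hx, hfx⟩ ⟨⟨x', y'⟩, hx', hfx'⟩ (rfl : y = y')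
    obtain rfl : x = x' := hinj y hx.2 hx.1 hx'.1 (hfx.trans hfx'.symm)
    rfl
  have hrange : t ⊆ Set.range proj := fun y hy =>
    (hz y hy).elim fun x hx => ⟨⟨(x, y), ⟨hx.1, hy⟩, hx.2⟩, rfl⟩
  have huniv := ht'.preimage_of_isClosedMap hproj_inj hproj hrange
  rw [Set.eq_univ_of_forall (s := proj ⁻¹' t) fun p => p.2.1.2] at huniv
  exact isPreconnected_iff_preconnectedSpace.2 ⟨huniv⟩

-- The zeros of `f` form a connected set joining the sides on which `g` has opposite signs.
theorem exists_common_zero {f g : ℝ × ℝ → ℝ} {a₀ a₁ b₀ b₁ : ℝ} (ha : a₀ ≤ a₁) (hb : b₀ ≤ b₁)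
    (hf : ContinuousOn f (Set.Icc a₀ a₁ ×ˢ Set.Icc b₀ b₁))
    (hg : ContinuousOn g (Set.Icc a₀ a₁ ×ˢ Set.Icc b₀ b₁))
    (hinj : ∀ y ∈ Set.Icc b₀ b₁, Set.InjOn (fun x => f (x, y)) (Set.Icc a₀ a₁))
    (hf₀ : ∀ y ∈ Set.Icc b₀ b₁, 0 ≤ f (a₀, y)) (hf₁ : ∀ y ∈ Set.Icc b₀ b₁, f (a₁, y) ≤ 0)
    (hg₀ : ∀ x ∈ Set.Icc a₀ a₁, 0 ≤ g (x, b₀)) (hg₁ : ∀ x ∈ Set.Icc a₀ a₁, g (x, b₁) ≤ 0) :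
    ∃ z ∈ Set.Icc a₀ a₁ ×ˢ Set.Icc b₀ b₁, f z = 0 ∧ g z = 0 := by
  have hzero (y : ℝ) (hy : y ∈ Set.Icc b₀ b₁) : ∃ x ∈ Set.Icc a₀ a₁, f (x, y) = 0 :=
    intermediate_value_Icc' ha (hf.comp (by fun_prop) fun x hx => ⟨hx, hy⟩) ⟨hf₁ y hy, hf₀ y hy⟩
  have hconn := isPreconnected_fiber_of_injOn isCompact_Icc isCompact_Icc isPreconnected_Icc
    hf hinj hzero
  obtain ⟨x₀, hx₀, h₀⟩ := hzero b₀ (Set.left_mem_Icc.2 hb)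
  obtain ⟨x₁, hx₁, h₁⟩ := hzero b₁ (Set.right_mem_Icc.2 hb)
  obtain ⟨z, ⟨hz, hfz⟩, hgz⟩ := hconn.intermediate_value
    ⟨⟨hx₁, Set.right_mem_Icc.2 hb⟩, h₁⟩ ⟨⟨hx₀, Set.left_mem_Icc.2 hb⟩, h₀⟩
    (hg.mono Set.inter_subset_left) ⟨hg₁ x₁ hx₁, hg₀ x₀ hx₀⟩
  exact ⟨z, hz, hfz, hgz⟩

/-! ### Rotation numbers -/

theorem angleMap_mem_Icc (c : ℝ × ℝ) (u : ℝ) :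
    angleMap c u ∈ Set.Icc (⌊u⌋ + 1 / 2 : ℝ) (⌊u⌋ + 3 / 2) :=
  turn_mem_Icc ⟨Int.floor_le u, (Int.lt_floor_add_one u).le⟩

theorem angleMap_monotone (c : ℝ × ℝ) : Monotone (angleMap c) := by
  intro u v h
  rcases (Int.floor_mono h).eq_or_lt with hfloor | hfloor
  · rw [angleMap, angleMap, hfloor]
    exact (turn _).monotone h
  · have : (⌊u⌋ : ℝ) + 1 ≤ ⌊v⌋ := by exact_mod_cast hfloor
    linarith [(angleMap_mem_Icc c u).2, (angleMap_mem_Icc c v).1]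

theorem angleMap_add_two (c : ℝ × ℝ) (u : ℝ) : angleMap c (u + 2) = angleMap c u + 2 := by
  have hside : side ⌊u + 2⌋ = side ⌊u⌋ := by
    rw [Int.floor_add_ofNat]
    exact side_add_two_mul _ 1
  have := map_add_two_mul_int (turn ((side ⌊u⌋).value c)) u 1
  rw [Int.cast_one, mul_one] at this
  rw [angleMap, hside, this, angleMap]

/-- The lift of the action of `F` on directions, with angles measured in full turns. -/
noncomputable def directionLift (c : ℝ × ℝ) : CircleDeg1Lift where
  toFun x := angleMap c (2 * x) / 2
  monotone' x y h := by
    have := angleMap_monotone c (mul_le_mul_of_nonneg_left h zero_le_two)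
    linarith
  map_add_one' x := by
    rw [mul_add, mul_one, angleMap_add_two]
    ring

theorem directionLift_pow_half (c : ℝ × ℝ) (n : ℕ) (u : ℝ) :
    (directionLift c ^ n) (u / 2) = (angleMap c)^[n] u / 2 := by
  rw [CircleDeg1Lift.coe_pow]
  refine (Function.Semiconj.iterate_right (f := fun v => v / 2) (fun v => ?_) n u).symm
  change angleMap c v / 2 = angleMap c (2 * (v / 2)) / 2
  rw [mul_div_cancel₀ v two_ne_zero]

theorem abCount_add_two (c z : ℝ × ℝ) (n : ℕ) : abCount c z (n + 2) = abCount c z (n + 1) +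
    if code c z n = .a ∧ code c z (n + 1) = .b then 1 else 0 := by
  have habCount (m : ℕ) : abCount c z (m + 1)
      = ∑ t ∈ Finset.range m, if code c z t = .a ∧ code c z (t + 1) = .b then 1 else 0 := by
    rw [abCount, Finset.card_filter, Finset.sum_range_succ, if_neg (by simp), add_zero]
    refine Finset.sum_congr rfl fun t ht => ?_
    simp only [Nat.add_lt_add_right (Finset.mem_range.1 ht) 1, true_and]
  rw [habCount, habCount, Finset.sum_range_succ]

theorem round_half (v : ℝ) : round (v / 2) = (⌊v⌋ + 1) / 2 := by
  have hsum : v / 2 + 1 / 2 = (v + 1) / 2 := by ring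
  rw [round_eq, hsum, ← Int.floor_add_one]
  exact_mod_cast Int.floor_div_natCast (v + 1) 2

-- A passage from the half-plane of `a` to that of `b` is a crossing of an odd integer angle.
theorem round_half_angleMap (c : ℝ × ℝ) (v : ℝ) : round (angleMap c v / 2) = round (v / 2) +
    if side ⌊v⌋ = .a ∧ side ⌊angleMap c v⌋ = .b then 1 else 0 := by
  have hv := angleMap_mem_Icc c v
  have hlower : ⌊v⌋ ≤ ⌊angleMap c v⌋ := Int.le_floor.2 (by linarith [hv.1])
  have hupper : ⌊angleMap c v⌋ < ⌊v⌋ + 2 := Int.floor_lt.2 (by push_cast; linarith [hv.2])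
  have ha (k : ℤ) : side k = .a ↔ k % 2 = 0 := by simp [side, Int.even_iff]
  have hb (k : ℤ) : side k = .b ↔ k % 2 ≠ 0 := by simp [side, Int.even_iff]
  simp only [round_half, ha, hb]
  split_ifs <;> omega

theorem abCount_smul_direction (c : ℝ × ℝ) {r : ℝ} (hr : 0 < r) (u : ℝ) (n : ℕ) :
    (abCount c (r • direction u) (n + 1) : ℤ)
      = round ((angleMap c)^[n] u / 2) - round (u / 2) := by
  induction n with
  | zero => simp [abCount]
  | succ n ih =>
    rw [abCount_add_two, Nat.cast_add, ih, code_smul_direction hr, code_smul_direction hr,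
      Function.iterate_succ_apply', round_half_angleMap]
    push_cast
    ring

theorem dist_abCount_le (c : ℝ × ℝ) {r : ℝ} (hr : 0 < r) (u : ℝ) (n : ℕ) :
    dist ((directionLift c ^ n) (u / 2) - u / 2) (abCount c (r • direction u) n) ≤ 2 := by
  rw [directionLift_pow_half, Real.dist_eq]
  cases n with
  | zero => simp [abCount]
  | succ n =>
    have hcount : (abCount c (r • direction u) (n + 1) : ℝ)
        = round ((angleMap c)^[n] u / 2) - round (u / 2) := by
      exact_mod_cast abCount_smul_direction c hr u n
    rw [hcount, Function.iterate_succ_apply']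
    generalize (angleMap c)^[n] u = v
    have hstep := angleMap_mem_Icc c v
    have hu := abs_le.1 (abs_sub_round (u / 2))
    have hv := abs_le.1 (abs_sub_round (v / 2))
    rw [abs_le]
    constructor <;> linarith [Int.floor_le v, Int.lt_floor_add_one v, hstep.1, hstep.2]

theorem hasRotationNumber_translationNumber (c : ℝ × ℝ) :
    HasRotationNumber c (directionLift c).translationNumber := by
  intro z hz
  obtain ⟨r, hr, u, rfl⟩ := exists_eq_smul_direction hz
  have hbound : Tendsto (fun n : ℕ => 2 / (n : ℝ)) atTop (𝓝 0) :=
    tendsto_const_div_atTop_nhds_zero_nat 2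
  refine ((directionLift c).tendsto_translationNumber (u / 2)).congr_dist
    (squeeze_zero (fun _ => dist_nonneg) (fun n => ?_) hbound)
  rw [Real.dist_eq, ← sub_div, abs_div, Nat.abs_cast]
  exact div_le_div_of_nonneg_right (dist_abCount_le c hr u n) n.cast_nonneg

theorem hasRotationNumber_of_iterate_eq {c : ℝ × ℝ} {N k : ℕ} (hN : 0 < N)
    (h : (angleMap c)^[N] 0 = 2 * k) : HasRotationNumber c (k / N) := by
  have hperiod : (directionLift c ^ N) (0 / 2) = 0 / 2 + (k : ℤ) := by
    rw [directionLift_pow_half, h]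
    push_cast
    ring
  have := (directionLift c).translationNumber_of_map_pow_eq_add_int hperiod hN
  rw [Int.cast_natCast] at this
  exact this ▸ hasRotationNumber_translationNumber c

theorem hasRotationNumber_of_isLegal {c : ℝ × ℝ} {v v' : List Letter} {n m : ℕ}
    (h : IsLegal (.a :: v) c) (h' : IsLegal (.b :: v') c)
    (hn : letterChanges .a v = 2 * n) (hm : letterChanges .b v' = 2 * m) :
    HasRotationNumber c
      ((n + m + 1 : ℕ) / ((Letter.a :: v).length + (Letter.b :: v').length : ℕ)) := by
  refine hasRotationNumber_of_iterate_eq (by simp) ?_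
  have hfirst := h.iterate_angleMap (i := 0) rfl
  have hsecond := h'.iterate_angleMap (i := 2 * n + 1) (by simp [side])
  rw [hn] at hfirst
  rw [hm] at hsecond
  push_cast at hfirst hsecond ⊢
  rw [zero_add] at hfirst
  rw [add_comm (List.length _), Function.iterate_add_apply, hfirst, hsecond]
  ring

/-! ### Intersections of critical curves -/

/-- The curve of `w`, a word with first letter `l` and `2 n` changes of letter, separates the two
sides of `D` on which the parameter `l` is `s₀` and `s₁`. The curve is described by the angle
`wordTurn c w 0`, which is `2 n + 1` at the legal points. The form required of `w` makes the
rank odd and this angle strictly decreasing in the parameter `l`. -/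
structure Crosses (D : Set (ℝ × ℝ)) (l : Letter) (s₀ s₁ : ℝ) (n : ℕ) (w : List Letter) :
    Prop where
  exists_eq_cons : ∃ v, w = l :: l :: v ∧ (l :: v).Palindrome
  letterChanges_eq : letterChanges l w = 2 * n
  isLegal : ∀ c ∈ D, wordTurn c w 0 = 2 * n + 1 → IsLegal w c
  le_wordTurn : ∀ c ∈ D, l.value c = s₀ → 2 * n + 1 ≤ wordTurn c w 0
  wordTurn_le : ∀ c ∈ D, l.value c = s₁ → wordTurn c w 0 ≤ 2 * n + 1

namespace Crosses

variable {D : Set (ℝ × ℝ)} {l : Letter} {s₀ s₁ : ℝ} {n : ℕ} {w : List Letter}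

theorem isLegal_of_mem_legalBranch (h : Crosses D l s₀ s₁ n w) {c : ℝ × ℝ} (hD : c ∈ D)
    (hc : c ∈ legalBranch w) : IsLegal w c := by
  refine h.isLegal c hD ?_
  have hchanges := h.letterChanges_eq
  obtain ⟨v, rfl, hv⟩ := h.exists_eq_cons
  rw [letterChanges, if_pos rfl, zero_add] at hchanges
  rw [wordTurn_eq_of_mem_legalBranch hv hc, hchanges]
  push_cast
  ring

theorem mem_legalBranch (h : Crosses D l s₀ s₁ n w) {c : ℝ × ℝ} (hD : c ∈ D)
    (hc : wordTurn c w 0 = 2 * n + 1) : c ∈ legalBranch w := by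
  have hlegal := h.isLegal c hD hc
  have hchanges := h.letterChanges_eq
  obtain ⟨v, rfl, hv⟩ := h.exists_eq_cons
  rw [letterChanges, if_pos rfl, zero_add] at hchanges
  exact hlegal.mem_legalBranch hv hchanges

theorem wordTurn_lt (h : Crosses D l s₀ s₁ n w) {c d : ℝ × ℝ}
    (hle : ∀ x : Letter, x.value c ≤ x.value d) (hlt : l.value c < l.value d) :
    wordTurn d w 0 < wordTurn c w 0 := by
  obtain ⟨v, rfl, -⟩ := h.exists_eq_cons
  exact wordTurn_cons_cons_lt hle hlt v

end Crosses

theorem Crosses.hasRotationNumber {D D' : Set (ℝ × ℝ)} {s₀ s₁ s₀' s₁' : ℝ} {n m : ℕ}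
    {w w' : List Letter} (hw : Crosses D .a s₀ s₁ n w) (hw' : Crosses D' .b s₀' s₁' m w')
    {c : ℝ × ℝ} (hc : IsLegal w c) (hc' : IsLegal w' c) :
    HasRotationNumber c ((n + m + 1 : ℕ) / (w.length + w'.length : ℕ)) := by
  have hn := hw.letterChanges_eq
  have hm := hw'.letterChanges_eq
  obtain ⟨v, rfl, -⟩ := hw.exists_eq_cons
  obtain ⟨v', rfl, -⟩ := hw'.exists_eq_cons
  rw [letterChanges, if_pos rfl, zero_add] at hn hm
  exact hasRotationNumber_of_isLegal hc hc' hn hm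

theorem Crosses.exists_wordTurn_eq {a₀ a₁ b₀ b₁ : ℝ} (ha : a₀ ≤ a₁) (hb : b₀ ≤ b₁) {n m : ℕ}
    {w w' : List Letter} (hw : Crosses (Set.Icc a₀ a₁ ×ˢ Set.Icc b₀ b₁) .a a₀ a₁ n w)
    (hw' : Crosses (Set.Icc a₀ a₁ ×ˢ Set.Icc b₀ b₁) .b b₀ b₁ m w') :
    ∃ c ∈ Set.Icc a₀ a₁ ×ˢ Set.Icc b₀ b₁,
      wordTurn c w 0 = 2 * n + 1 ∧ wordTurn c w' 0 = 2 * m + 1 := by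
  have hanti (y : ℝ) : StrictAnti fun x : ℝ => wordTurn (x, y) w 0 := fun x x' hx =>
    hw.wordTurn_lt (by rintro (_ | _) <;> [exact hx.le; exact le_rfl]) hx
  obtain ⟨c, hD, hc, hc'⟩ := exists_common_zero
    (f := fun c => wordTurn c w 0 - (2 * n + 1)) (g := fun c => wordTurn c w' 0 - (2 * m + 1))
    ha hb ((continuous_wordTurn w 0).sub continuous_const).continuousOn
    ((continuous_wordTurn w' 0).sub continuous_const).continuousOn
    (fun y _ => (sub_left_injective.comp (hanti y).injective).injOn)
    (fun y hy => sub_nonneg.2 (hw.le_wordTurn _ ⟨Set.left_mem_Icc.2 ha, hy⟩ rfl))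
    (fun y hy => sub_nonpos.2 (hw.wordTurn_le _ ⟨Set.right_mem_Icc.2 ha, hy⟩ rfl))
    (fun x hx => sub_nonneg.2 (hw'.le_wordTurn _ ⟨hx, Set.left_mem_Icc.2 hb⟩ rfl))
    (fun x hx => sub_nonpos.2 (hw'.wordTurn_le _ ⟨hx, Set.right_mem_Icc.2 hb⟩ rfl))
  exact ⟨c, hD, sub_eq_zero.1 hc, sub_eq_zero.1 hc'⟩

theorem Crosses.meetWithRotationNumber {a₀ a₁ b₀ b₁ : ℝ} (ha : a₀ ≤ a₁) (hb : b₀ ≤ b₁) {n m : ℕ}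
    {w w' : List Letter} (hw : Crosses (Set.Icc a₀ a₁ ×ˢ Set.Icc b₀ b₁) .a a₀ a₁ n w)
    (hw' : Crosses (Set.Icc a₀ a₁ ×ˢ Set.Icc b₀ b₁) .b b₀ b₁ m w') :
    MeetWithRotationNumber (Set.Icc a₀ a₁ ×ˢ Set.Icc b₀ b₁) w w'
      ((n + m + 1 : ℕ) / (w.length + w'.length : ℕ)) := by
  constructor
  · obtain ⟨c, hD, hc, hc'⟩ := exists_wordTurn_eq ha hb hw hw'
    exact ⟨c, ⟨hw.mem_legalBranch hD hc, hw'.mem_legalBranch hD hc'⟩, hD⟩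
  · rintro c ⟨hc, hc'⟩ (hD | ⟨hlegal, hlegal'⟩)
    · exact hw.hasRotationNumber hw' (hw.isLegal_of_mem_legalBranch hD hc)
        (hw'.isLegal_of_mem_legalBranch hD hc')
    · exact hw.hasRotationNumber hw' hlegal hlegal'

theorem isLegal_of_follows {l : Letter} {w : List Letter} {c : ℝ × ℝ} {k : ℤ}
    (hfollows : ∀ i : ℤ, side i = l → Follows c (l :: w) i)
    (h : wordTurn c (l :: w) 0 = k) : IsLegal (l :: w) c := by
  obtain ⟨i, hi⟩ := exists_side_eq l
  refine (isLegal_cons_iff hi w c).2 ⟨hfollows i hi, k + i, ?_⟩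
  rw [← zero_add (i : ℝ), CircleDeg1Lift.map_add_int, h, Int.cast_add]

section Strip

variable {D : Set (ℝ × ℝ)} {l l' : Letter} {p q : ℕ}

theorem crosses_minusWord (hl : l ≠ l') (hp : 2 ≤ p) (hq : 2 ≤ q)
    (hD : ∀ c ∈ D, l.value c ∈ Set.Icc (zeta p) (zeta (p + 1)))
    (hD' : ∀ c ∈ D, l'.value c ∈ Set.Icc (zeta q) (zeta (q + 1))) (n : ℕ) :
    Crosses D l (zeta p) (zeta (p + 1)) n (minusWord l l' p q n) := by
  have hA {c : ℝ × ℝ} (hc : c ∈ D) := turn_pow_zero_le_one hp (hD c hc).1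
  have hA' {c : ℝ × ℝ} (hc : c ∈ D) := one_le_turn_pow_zero (by omega) (hD c hc).2
  have hB {c : ℝ × ℝ} (hc : c ∈ D) := turn_pow_zero_le_one hq (hD' c hc).1
  have hB' {c : ℝ × ℝ} (hc : c ∈ D) := one_le_turn_pow_zero (by omega) (hD' c hc).2
  obtain ⟨p, rfl⟩ := Nat.exists_eq_add_of_le' hp
  obtain ⟨q, rfl⟩ := Nat.exists_eq_add_of_le' hq
  obtain ⟨v, hw, hv⟩ := exists_minusWord_eq_cons l l' p (q + 2) n
  refine ⟨⟨v, hw, hv⟩, letterChanges_minusWord hl p (q + 1) n, fun c hc h => ?_,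
    fun c hc h => ?_, fun c hc h => ?_⟩
  · rw [hw]
    refine isLegal_of_follows (k := 2 * n + 1) (fun i hi => hw ▸
      follows_minusWord hi hl.symm (hA hc) (hA' hc) (hB hc) h) ?_
    rw [← hw, h]
    norm_cast
  · exact le_wordTurn_minusWord (h ▸ turn_zeta_pow_zero hp) (hB' hc) n
  · exact wordTurn_minusWord_le (hA hc) (h ▸ turn_zeta_pow_zero (by omega)) (hB hc) n

theorem crosses_plusWord (hl : l ≠ l') (hp : 2 ≤ p) (hq : 2 ≤ q)
    (hD : ∀ c ∈ D, l.value c ∈ Set.Icc (zeta p) (zeta (p + 1)))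
    (hD' : ∀ c ∈ D, l'.value c ∈ Set.Icc (zeta q) (zeta (q + 1))) (n : ℕ) :
    Crosses D l (zeta p) (zeta (p + 1)) n (plusWord l l' p q n) := by
  have hA {c : ℝ × ℝ} (hc : c ∈ D) := turn_pow_zero_le_one hp (hD c hc).1
  have hA' {c : ℝ × ℝ} (hc : c ∈ D) := one_le_turn_pow_zero (by omega) (hD c hc).2
  have hB {c : ℝ × ℝ} (hc : c ∈ D) := turn_pow_zero_le_one hq (hD' c hc).1
  have hB' {c : ℝ × ℝ} (hc : c ∈ D) := one_le_turn_pow_zero (by omega) (hD' c hc).2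
  obtain ⟨p, rfl⟩ := Nat.exists_eq_add_of_le' (one_le_two.trans hp)
  obtain ⟨v, hw, hv⟩ := exists_plusWord_eq_cons l l' p q n
  refine ⟨⟨v, hw, hv⟩, letterChanges_plusWord hl p q n, fun c hc h => ?_,
    fun c hc h => ?_, fun c hc h => ?_⟩
  · rw [hw]
    refine isLegal_of_follows (k := 2 * n + 1) (fun i hi => hw ▸
      follows_plusWord hi hl.symm (hA hc) (hA' hc) h) ?_
    rw [← hw, h]
    norm_cast
  · exact le_wordTurn_plusWord (h ▸ turn_zeta_pow_zero hp) (hB' hc) n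
  · exact wordTurn_plusWord_le (h ▸ turn_zeta_pow_zero (by omega)) (hB hc) n

end Strip

theorem thetaMinus_eq_div_length (κ ℓ n m : ℕ) :
    thetaMinus (κ + ℓ + 1) (n + m + 1) = (n + m + 1 : ℕ) /
      ((minusWord .a .b κ ℓ n).length + (minusWord .b .a ℓ κ m).length : ℕ) := by
  rw [length_minusWord, length_minusWord, thetaMinus]
  congr 1
  push_cast
  ring

theorem thetaPlus_eq_div_length (κ ℓ n m : ℕ) :
    thetaPlus (κ + ℓ + 1) (n + m + 1) = (n + m + 1 : ℕ) /
      ((plusWord .a .b κ ℓ n).length + (plusWord .b .a ℓ κ m).length : ℕ) := by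
  rw [length_plusWord, length_plusWord, thetaPlus]
  congr 1
  push_cast
  ring

end CriticalCurves

theorem mainTheorem12 (κ ℓ n m : ℕ) (hκ : 2 ≤ κ) (hℓ : 2 ≤ ℓ) :
    MeetWithRotationNumber (rotDomain κ ℓ)
        (wordPow (aPow (κ + 1) ++ bPow ℓ) n ++ aPow κ)
        (wordPow (bPow (ℓ + 1) ++ aPow κ) m ++ bPow ℓ)
        (thetaMinus (κ + ℓ + 1) (n + m + 1)) ∧
      MeetWithRotationNumber (rotDomain κ ℓ)
        (aPow (κ + 1) ++ wordPow (bPow (ℓ + 1) ++ aPow κ) n)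
        (bPow (ℓ + 1) ++ wordPow (aPow (κ + 1) ++ bPow ℓ) m)
        (thetaPlus (κ + ℓ + 1) (n + m + 1)) := by
  have ha : ∀ c ∈ rotDomain κ ℓ, Letter.a.value c ∈ Set.Icc (zeta κ) (zeta (κ + 1)) :=
    fun _ hc => hc.1
  have hb : ∀ c ∈ rotDomain κ ℓ, Letter.b.value c ∈ Set.Icc (zeta ℓ) (zeta (ℓ + 1)) :=
    fun _ hc => hc.2
  have hab : Letter.a ≠ .b := nofun
  have hκ_le := zeta_le_zeta_succ (one_le_two.trans hκ)
  have hℓ_le := zeta_le_zeta_succ (one_le_two.trans hℓ)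
  rw [thetaMinus_eq_div_length, thetaPlus_eq_div_length]
  exact ⟨(crosses_minusWord hab hκ hℓ ha hb n).meetWithRotationNumber hκ_le hℓ_le
      (crosses_minusWord hab.symm hℓ hκ hb ha m),
    (crosses_plusWord hab hκ hℓ ha hb n).meetWithRotationNumber hκ_le hℓ_le
      (crosses_plusWord hab.symm hℓ hκ hb ha m)⟩
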